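/- A polytope in $\mathbb{R}^3$ is the convex hull of a nonempty finite set of points; a polygon is a $2$-dimensional polytope, and line segments are assumed to be non-degenerate. A $3$-dimensional polytope is called equiprojective when there is an integer $k$ such that its orthogonal projection along any line that is not parallel to one of its facets is a polygon with exactly $k$ vertices. For a polytope $P\subset\mathbb{R}^3$ (of any dimension) and a nonempty face $F$ of $P$, the normal cone of $P$ at $F$ is $$N_P(F)=\{v\in\mathbb{R}^3 : v\cdot x\le v\cdot y \text{ for all } x\in P,\ y\in F\}.$$ For a nonzero vector $u$, the aggregated cone $C_P(u)$ is the union of all the $2$-dimensional normal cones of $P$ that are contained in the plane $u^\perp$ through the origin orthogonal to $u$. A unit vector $u$ is an edge direction of $P$ when its first nonzero coordinate is positive and $P$ has an edge ($1$-dimensional face) whose difference of vertices is a multiple of $u$. **Theorem.** Let $P$ and $Q$ each be an equiprojective polytope, a polygon, or a line segment contained in $\mathbb{R}^3$, and assume that the Minkowski sum $P+Q$ is $3$-dimensional. Then $P+Q$ is equiprojective if and only if, for every vector $u$ that is an edge direction of both $P$ and $Q$, at least one of the following holds: (i) $C_P(u)=u^\perp$ or $C_Q(u)=u^\perp$; (ii)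 $C_P(u)=C_Q(u)$ or $C_P(u)=-C_Q(u)$. -/

import Mathlib

open scoped Pointwise

namespace EquiprojectivePolytopes

/-- Euclidean 3-space. -/
abbrev E3 : Type := EuclideanSpace ℝ (Fin 3)

/-- A polytope: the convex hull of a nonempty finite set of points. -/
def IsPolytope (P : Set E3) : Prop :=
  ∃ S : Finset E3, S.Nonempty ∧ P = convexHull ℝ (S : Set E3)

/-- The dimension of a nonempty subset of space, i.e. the dimension of its affine hull. -/
noncomputable def dim (A : Set E3) : ℕ :=
  Module.finrank ℝ (vectorSpan ℝ A)

/-- A polygon in space: a 2-dimensional polytope. -/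
def IsPolygon (P : Set E3) : Prop :=
  IsPolytope P ∧ dim P = 2

/-- A (non-degenerate) line segment. -/
def IsLineSegment (P : Set E3) : Prop :=
  ∃ a b : E3, a ≠ b ∧ P = segment ℝ a b

/-- The nonempty faces of a polytope `P` (including `P` itself): the subsets of `P` where some
linear functional attains its maximum over `P`. -/
def IsFace (P F : Set E3) : Prop :=
  F.Nonempty ∧ IsExposed ℝ P F

/-- An edge is a 1-dimensional face. -/
def IsEdge (P e : Set E3) : Prop :=
  IsFace P e ∧ dim e = 1

/-- A facet of a 3-dimensional polytope is a 2-dimensional face. -/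
def IsFacet (P F : Set E3) : Prop :=
  IsFace P F ∧ dim F = 2

/-- The plane `u^⊥` through the origin orthogonal to a non-zero vector `u`. -/
def perp (u : E3) : Set E3 :=
  ((Submodule.span ℝ {u})ᗮ : Submodule ℝ E3)

/-- The orthogonal projection of `P` on the plane `d^⊥`. -/
noncomputable def projAlong (d : E3) (P : Set E3) : Set E3 :=
  (Submodule.span ℝ {d})ᗮ.starProjection '' P

/-- A 3-dimensional polytope `P` is `k`-equiprojective when its orthogonal projection along any
line that is not parallel to a facet of `P` is a polygon with `k` vertices. -/
def IsKEquiprojective (k : ℕ) (P : Set E3) : Prop :=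
  IsPolytope P ∧ dim P = 3 ∧
    ∀ d : E3, d ≠ 0 → (∀ F : Set E3, IsFacet P F → d ∉ vectorSpan ℝ F) →
      ((projAlong d P).extremePoints ℝ).encard = k

/-- Equiprojective: `k`-equiprojective for some `k`. -/
def IsEquiprojective (P : Set E3) : Prop :=
  ∃ k : ℕ, IsKEquiprojective k P

/-- The normal cone of `P` at `F`. -/
def normalCone (P F : Set E3) : Set E3 :=
  {v | ∀ x ∈ P, ∀ y ∈ F, inner ℝ v x ≤ inner ℝ v y}

/-- The dimension of a cone with apex the origin: the dimension of its linear span. -/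
noncomputable def coneDim (C : Set E3) : ℕ :=
  Module.finrank ℝ (Submodule.span ℝ C)

/-- The aggregated cone `C_P(u)`: the union of the 2-dimensional normal cones of `P` (at its
faces) that are contained in the plane `u^⊥`. -/
def aggregatedCone (P : Set E3) (u : E3) : Set E3 :=
  ⋃₀ {N | ∃ F : Set E3, IsFace P F ∧ N = normalCone P F ∧ coneDim N = 2 ∧ N ⊆ perp u}

/-- A unit vector `u` is an edge direction of `P` when its first non-zero coordinate is positive
and there is an edge of `P` whose difference of vertices is a multiple of `u`. -/
def IsEdgeDirection (P : Set E3) (u : E3) : Prop :=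
  ‖u‖ = 1 ∧
  (∃ i : Fin 3, 0 < u i ∧ ∀ j : Fin 3, j < i → u j = 0) ∧
  ∃ e : Set E3, IsEdge P e ∧
    ∃ x ∈ e.extremePoints ℝ, ∃ y ∈ e.extremePoints ℝ, x ≠ y ∧ ∃ c : ℝ, y - x = c • u

end EquiprojectivePolytopes

open scoped InnerProductSpace Topology
open Filter

namespace EquiprojectivePolytopes

/-! For a finite set `A` and a direction `u`, `edgeNormals A u` collects the vectors of the plane
orthogonal to `u` that expose an edge of the hull parallel to `u`. Its closure is the aggregated
cone (`aggregatedCone_eq_closure`), so the whole question can be asked about these sets.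

Project along a generic `d`. The resulting polygon has as many vertices as edges, and each of its
edges comes from an edge of the polytope, of some direction `u`, whose outer normal is orthogonal to
both `u` and `d`. That normal is a positive multiple of `cross u d` or of its opposite. So the
number of vertices is the sum over `u` of `edgeCount A u (cross u d)`
(`encard_extremePoints_projAlong`).

It follows that a 3-dimensional polytope is equiprojective if and only if it is balanced: each
`edgeCount A u` is constant on the generic vectors orthogonal to `u`. If every summand is constant,
so is the sum (`IsBalanced.isEquiprojective`). Conversely, `d` is taken on four curves tangent to a
given direction `u₀` up to second order. In a signed sum of the four vertex counts the terms of all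
other directions cancel (`curveCount_exchange`), so `edgeCount A u₀` takes equal values on the two
sides of every ray orthogonal to `u₀` (`sideCount_eq_of_isEquiprojective`). Connectedness of the
punctured plane makes it constant (`exists_edgeCount_eq`). Polygons and segments are balanced by
direct inspection.

The face of a Minkowski sum is the sum of the faces, so at generic vectors the edge normals of `A +
B` are the union of those of `A` and of `B`. Where `u` is a direction of both, the constants of `A`
and `B` are 1 or 2. The value 2 means that the cone is the whole plane. If both are 1, each set
contains exactly one vector of every generic pair `w`, `-w`, and the union has a constant count
exactly when the two choices agree everywhere (count 1) or are opposite everywhere (count 2). These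
are the alternatives of the theorem. -/

/-! ### The cross product on `E3` -/

/-- The cross product of two vectors of Euclidean 3-space. -/
noncomputable def cross (a b : E3) : E3 :=
  !₂[a 1 * b 2 - a 2 * b 1, a 2 * b 0 - a 0 * b 2, a 0 * b 1 - a 1 * b 0]

theorem inner_eq_sum (a b : E3) : ⟪a, b⟫_ℝ = a 0 * b 0 + a 1 * b 1 + a 2 * b 2 := by
  simp [PiLp.inner_apply, Fin.sum_univ_three]; ring

theorem cross_apply_zero (a b : E3) : cross a b 0 = a 1 * b 2 - a 2 * b 1 := by simp [cross]
theorem cross_apply_one (a b : E3) : cross a b 1 = a 2 * b 0 - a 0 * b 2 := by simp [cross]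
theorem cross_apply_two (a b : E3) : cross a b 2 = a 0 * b 1 - a 1 * b 0 := by simp [cross]

theorem inner_cross_left (a b : E3) : ⟪cross a b, a⟫_ℝ = 0 := by
  simp only [inner_eq_sum, cross_apply_zero, cross_apply_one, cross_apply_two]; ring

theorem inner_cross_right (a b : E3) : ⟪cross a b, b⟫_ℝ = 0 := by
  simp only [inner_eq_sum, cross_apply_zero, cross_apply_one, cross_apply_two]; ring

theorem cross_add_right (a b c : E3) : cross a (b + c) = cross a b + cross a c := by
  ext i; fin_cases i <;> simp [cross] <;> ring

theorem cross_smul_right (r : ℝ) (a b : E3) : cross a (r • b) = r • cross a b := by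
  ext i; fin_cases i <;> simp [cross] <;> ring

theorem cross_smul_left (r : ℝ) (a b : E3) : cross (r • a) b = r • cross a b := by
  ext i; fin_cases i <;> simp [cross] <;> ring

theorem cross_anticomm (a b : E3) : cross a b = -cross b a := by
  ext i; fin_cases i <;> simp [cross] <;> ring

theorem cross_self (a : E3) : cross a a = 0 := by
  ext i; fin_cases i <;> simp [cross] <;> ring

theorem cross_cross (a b c : E3) : cross a (cross b c) = ⟪a, c⟫_ℝ • b - ⟪a, b⟫_ℝ • c := by
  ext i; fin_cases i <;> simp [cross, inner_eq_sum] <;> ring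

theorem inner_cross_cross (a b c e : E3) :
    ⟪cross a b, cross c e⟫_ℝ = ⟪a, c⟫_ℝ * ⟪b, e⟫_ℝ - ⟪a, e⟫_ℝ * ⟪b, c⟫_ℝ := by
  simp only [inner_eq_sum, cross_apply_zero, cross_apply_one, cross_apply_two]; ring

theorem exists_smul_of_cross_eq_zero {a b : E3} (hb : b ≠ 0) (h : cross b a = 0) :
    ∃ c : ℝ, a = c • b := by
  have hc := cross_cross b b a
  have hz : cross b (0 : E3) = 0 := by ext i; fin_cases i <;> simp [cross]
  rw [h, hz] at hc
  have hbb : ⟪b, b⟫_ℝ ≠ 0 := inner_self_ne_zero.2 hb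
  refine ⟨(⟪b, b⟫_ℝ)⁻¹ * ⟪b, a⟫_ℝ, ?_⟩
  rw [mul_smul, eq_inv_smul_iff₀ hbb]
  exact (sub_eq_zero.1 hc.symm).symm

theorem cross_ne_zero_of_inner_eq_zero {a b : E3} (ha : a ≠ 0) (hb : b ≠ 0)
    (h : ⟪a, b⟫_ℝ = 0) : cross a b ≠ 0 := by
  intro h0
  obtain ⟨c, rfl⟩ := exists_smul_of_cross_eq_zero ha h0
  rw [inner_smul_right, mul_eq_zero] at h
  rcases h with h | h
  · exact hb (by simp [h])
  · exact ha (inner_self_eq_zero.1 h)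

/-- A vector orthogonal to `a` and `b` is a multiple of their cross product. -/
theorem exists_smul_cross {a b v : E3} (hab : cross a b ≠ 0) (ha : ⟪v, a⟫_ℝ = 0)
    (hb : ⟪v, b⟫_ℝ = 0) : ∃ c : ℝ, v = c • cross a b := by
  apply exists_smul_of_cross_eq_zero hab
  rw [cross_anticomm, cross_cross, ha, hb]
  simp

/-- A vector orthogonal to `u` is a combination of `n` and `cross u n` when `n ≠ 0` is orthogonal
to `u ≠ 0`. -/
theorem exists_combination {u n w : E3} (hu : u ≠ 0) (hn : n ≠ 0) (hun : ⟪n, u⟫_ℝ = 0)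
    (hw : ⟪w, u⟫_ℝ = 0) : ∃ a b : ℝ, w = a • n + b • cross u n := by
  have hm : cross u n ≠ 0 :=
    cross_ne_zero_of_inner_eq_zero hu hn (by rwa [real_inner_comm])
  have hnn : ⟪n, n⟫_ℝ ≠ 0 := inner_self_ne_zero.2 hn
  set a := (⟪n, n⟫_ℝ)⁻¹ * ⟪w, n⟫_ℝ
  have h1 : ⟪w - a • n, n⟫_ℝ = 0 := by
    rw [inner_sub_left, real_inner_smul_left]; simp only [a]; field_simp; ring
  have h2 : ⟪w - a • n, u⟫_ℝ = 0 := by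
    rw [inner_sub_left, real_inner_smul_left, hun, hw]; ring
  obtain ⟨b, hb⟩ := exists_smul_cross hm h2 h1
  exact ⟨a, b, by rw [← hb]; abel⟩

theorem mem_span_of_orthogonal {u n m v : E3} (hu : u ≠ 0) (hnm : cross n m ≠ 0)
    (hn : ⟪n, u⟫_ℝ = 0) (hm : ⟪m, u⟫_ℝ = 0) (hvn : ⟪n, v⟫_ℝ = 0) (hvm : ⟪m, v⟫_ℝ = 0) :
    v ∈ Submodule.span ℝ {u} := by
  rw [real_inner_comm] at hn hm hvn hvm
  obtain ⟨a, ha⟩ := exists_smul_cross hnm hn hm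
  obtain ⟨b, hb⟩ := exists_smul_cross hnm hvn hvm
  have ha0 : a ≠ 0 := by rintro rfl; exact hu (by simpa using ha)
  refine Submodule.mem_span_singleton.2 ⟨b * a⁻¹, ?_⟩
  rw [ha, hb, smul_smul]; congr 1; field_simp

/-! ### Normalized directions -/

/-- A unit vector whose first non-zero coordinate is positive. -/
def IsNormalized (u : E3) : Prop :=
  ‖u‖ = 1 ∧ ∃ i : Fin 3, 0 < u i ∧ ∀ j : Fin 3, j < i → u j = 0

theorem IsNormalized.ne_zero {u : E3} (hu : IsNormalized u) : u ≠ 0 := by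
  rintro rfl; simpa using hu.1

theorem IsNormalized.eq_of_mem_span {u v : E3} (hu : IsNormalized u) (hv : IsNormalized v)
    (h : u ∈ Submodule.span ℝ {v}) : u = v := by
  obtain ⟨c, rfl⟩ := Submodule.mem_span_singleton.1 h
  have hc : |c| = 1 := by simpa [norm_smul, hv.1] using hu.1
  rcases (abs_eq zero_le_one).1 hc with rfl | rfl
  · simp
  · exfalso
    obtain ⟨-, i, hi, hi'⟩ := hu
    obtain ⟨-, j, hj, hj'⟩ := hv
    simp only [neg_smul, one_smul, PiLp.neg_apply] at hi hi'
    rcases lt_trichotomy i j with hij | rfl | hij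
    · have := hj' i hij; linarith
    · linarith
    · have := hi' j hij; linarith

theorem exists_isNormalized {v : E3} (hv : v ≠ 0) :
    ∃ u, IsNormalized u ∧ Submodule.span ℝ {v} = Submodule.span ℝ {u} := by
  classical
  have hex : ∃ i : Fin 3, v i ≠ 0 := by
    by_contra! h
    exact hv (by ext i; simpa using h i)
  have hne : (Finset.univ.filter fun i : Fin 3 => v i ≠ 0).Nonempty := by
    obtain ⟨i, hi⟩ := hex
    exact ⟨i, by simpa using hi⟩
  set i := (Finset.univ.filter fun i : Fin 3 => v i ≠ 0).min' hne
  have hi : v i ≠ 0 := by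
    have := Finset.min'_mem _ hne
    exact (Finset.mem_filter.1 this).2
  have hj : ∀ j < i, v j = 0 := by
    intro j hj
    by_contra h
    exact absurd (Finset.min'_le (Finset.univ.filter fun i : Fin 3 => v i ≠ 0) j (by simpa using h))
      (not_le.2 hj)
  have hn : ‖v‖ ≠ 0 := norm_ne_zero_iff.2 hv
  have key : ∀ c : ℝ, |c| = ‖v‖⁻¹ → 0 < c * v i →
      ∃ u, IsNormalized u ∧ Submodule.span ℝ {v} = Submodule.span ℝ {u} := by
    intro c hc hci
    have hc0 : c ≠ 0 := by rintro rfl; simp at hci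
    refine ⟨c • v, ⟨?_, i, by simpa using hci, fun j hji => by simp [hj j hji]⟩, ?_⟩
    · rw [norm_smul, Real.norm_eq_abs, hc, inv_mul_cancel₀ hn]
    · exact (Submodule.span_singleton_smul_eq (IsUnit.mk0 c hc0) v).symm
  have hpos : 0 < ‖v‖⁻¹ := by positivity
  rcases lt_or_gt_of_ne hi with h | h
  · exact key (-‖v‖⁻¹) (by rw [abs_neg, abs_of_pos hpos])
      (mul_pos_of_neg_of_neg (by linarith) h)
  · exact key ‖v‖⁻¹ (abs_of_pos hpos) (mul_pos hpos h)

/-! ### Faces exposed by a vector -/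

/-- The points of `A` where the scalar product with `w` is maximal over `A`. -/
def face (A : Set E3) (w : E3) : Set E3 :=
  {x | x ∈ A ∧ ∀ y ∈ A, ⟪w, y⟫_ℝ ≤ ⟪w, x⟫_ℝ}

theorem face_subset (A : Set E3) (w : E3) : face A w ⊆ A := fun _ hx => hx.1

theorem inner_eq_of_mem_face {A : Set E3} {w x y : E3} (hx : x ∈ face A w) (hy : y ∈ face A w) :
    ⟪w, x⟫_ℝ = ⟪w, y⟫_ℝ :=
  le_antisymm (hy.2 x hx.1) (hx.2 y hy.1)

theorem face_nonempty {A : Set E3} (hA : A.Finite) (hne : A.Nonempty) (w : E3) :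
    (face A w).Nonempty := by
  obtain ⟨x, hx, h⟩ := Set.exists_max_image A (fun x => ⟪w, x⟫_ℝ) hA hne
  exact ⟨x, hx, h⟩

theorem face_finite {A : Set E3} (hA : A.Finite) (w : E3) : (face A w).Finite :=
  hA.subset (face_subset A w)

theorem face_zero (A : Set E3) : face A 0 = A := by
  ext x; simp [face]

theorem face_smul (A : Set E3) {c : ℝ} (hc : 0 < c) (w : E3) : face A (c • w) = face A w := by
  ext x
  simp only [face, Set.mem_ofPred_eq, real_inner_smul_left, mul_le_mul_iff_right₀ hc]

/-- Adding to `w` a vector that is constant on `A` does not change the exposed face. -/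
theorem face_add_of_const {A : Set E3} {n w : E3}
    (hn : ∀ x ∈ A, ∀ y ∈ A, ⟪n, x⟫_ℝ = ⟪n, y⟫_ℝ) : face A (n + w) = face A w := by
  ext x
  simp only [face, Set.mem_ofPred_eq, inner_add_left]
  refine and_congr_right fun hx => forall₂_congr fun y hy => ?_
  rw [hn y hy x hx, add_le_add_iff_left]

theorem face_eq_self_of_const {A : Set E3} {w : E3}
    (hn : ∀ x ∈ A, ∀ y ∈ A, ⟪w, x⟫_ℝ = ⟪w, y⟫_ℝ) : face A w = A := by
  ext x
  exact ⟨fun h => h.1, fun h => ⟨h, fun y hy => (hn y hy x h).le⟩⟩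

/-- A point that is not maximal for `w` is beaten strictly by another one. This persists near `w`,
and only finitely many points are concerned. -/
theorem eventually_face_subset {A : Set E3} (hA : A.Finite) (w : E3) :
    ∀ᶠ v in 𝓝 w, face A v ⊆ face A w := by
  have h : ∀ x ∈ A, ∀ᶠ v in 𝓝 w, x ∈ face A v → x ∈ face A w := by
    intro x hx
    by_cases hxw : x ∈ face A w
    · exact Eventually.of_forall fun _ _ => hxw
    · have : ∃ y ∈ A, ⟪w, x⟫_ℝ < ⟪w, y⟫_ℝ := by
        by_contra! h
        exact hxw ⟨hx, h⟩
      obtain ⟨y, hy, hxy⟩ := this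
      have hlt : ∀ᶠ v in 𝓝 w, ⟪v, x⟫_ℝ < ⟪v, y⟫_ℝ :=
        (Continuous.tendsto (by fun_prop : Continuous fun v : E3 => ⟪v, x⟫_ℝ) w).eventually_lt
          (Continuous.tendsto (by fun_prop : Continuous fun v : E3 => ⟪v, y⟫_ℝ) w) hxy
      filter_upwards [hlt] with v hv hxv
      exact absurd (hxv.2 y hy) (not_le.2 hv)
  filter_upwards [(Set.Finite.eventually_all hA).2 h] with v hv x hx
  exact hv x hx.1 hx

/-- Near `w`, the exposed faces of `A` are exposed faces of `face A w`. -/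
theorem eventually_face_eq {A : Set E3} (hA : A.Finite) (hne : A.Nonempty) (w : E3) :
    ∀ᶠ v in 𝓝 w, face A v = face (face A w) v := by
  filter_upwards [eventually_face_subset hA w] with v hv
  obtain ⟨y, hy⟩ := face_nonempty hA hne v
  ext x
  constructor
  · exact fun hx => ⟨hv hx, fun z hz => hx.2 z hz.1⟩
  · exact fun hx => ⟨hx.1.1, fun z hz => (hy.2 z hz).trans (hx.2 y (hv hy))⟩

theorem eventually_face_add_smul {A : Set E3} (hA : A.Finite) (hne : A.Nonempty) (w m : E3) :
    ∀ᶠ t in 𝓝[>] (0 : ℝ), face A (w + t • m) = face (face A w) m := by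
  have ht : Tendsto (fun t : ℝ => w + t • m) (𝓝[>] 0) (𝓝 w) := by
    have : Continuous fun t : ℝ => w + t • m := by fun_prop
    simpa using (this.tendsto 0).mono_left nhdsWithin_le_nhds
  filter_upwards [ht.eventually (eventually_face_eq hA hne w), self_mem_nhdsWithin] with t h h0
  rw [h, face_add_of_const (fun x hx y hy => inner_eq_of_mem_face hx hy), face_smul _ h0]

/-- The lexicographic description of exposed faces along a curve of second order. -/
theorem eventually_face_add_smul_sq {A : Set E3} (hA : A.Finite) (hne : A.Nonempty)
    (a b c : E3) :
    ∀ᶠ t in 𝓝[>] (0 : ℝ),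
      face A (a + t • b + t ^ 2 • c) = face (face (face A a) b) c := by
  have ht : Tendsto (fun t : ℝ => a + t • b + t ^ 2 • c) (𝓝[>] 0) (𝓝 a) := by
    have : Continuous fun t : ℝ => a + t • b + t ^ 2 • c := by fun_prop
    simpa using (this.tendsto 0).mono_left nhdsWithin_le_nhds
  filter_upwards [ht.eventually (eventually_face_eq hA hne a), self_mem_nhdsWithin,
    eventually_face_add_smul (face_finite hA a) (face_nonempty hA hne a) b c] with t h h0 h1
  have e : a + t • b + t ^ 2 • c = a + t • (b + t • c) := by
    rw [smul_add, smul_smul, sq, add_assoc]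
  rw [h, e, face_add_of_const (fun x hx y hy => inner_eq_of_mem_face hx hy), face_smul _ h0, h1]

/-! ### Directions of faces -/

theorem inner_eq_zero_of_mem_vectorSpan {X : Set E3} {w z : E3}
    (h : ∀ x ∈ X, ∀ y ∈ X, ⟪w, x⟫_ℝ = ⟪w, y⟫_ℝ) (hz : z ∈ vectorSpan ℝ X) : ⟪w, z⟫_ℝ = 0 := by
  have hle : vectorSpan ℝ X ≤ (Submodule.span ℝ {w})ᗮ := by
    rw [vectorSpan_def, Submodule.span_le]
    rintro _ ⟨x, hx, y, hy, rfl⟩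
    rw [SetLike.mem_coe, Submodule.mem_orthogonal_singleton_iff_inner_right]
    simp [inner_sub_right, h x hx y hy]
  exact Submodule.mem_orthogonal_singleton_iff_inner_right.1 (hle hz)

theorem inner_eq_zero_of_mem_vectorSpan_face {A : Set E3} {w z : E3}
    (hz : z ∈ vectorSpan ℝ (face A w)) : ⟪w, z⟫_ℝ = 0 :=
  inner_eq_zero_of_mem_vectorSpan (fun _ hx _ hy => inner_eq_of_mem_face hx hy) hz

theorem inner_eq_of_vectorSpan_le {X : Set E3} {u w : E3}
    (h : vectorSpan ℝ X ≤ Submodule.span ℝ {u}) (hw : ⟪w, u⟫_ℝ = 0) :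
    ∀ x ∈ X, ∀ y ∈ X, ⟪w, x⟫_ℝ = ⟪w, y⟫_ℝ := by
  intro x hx y hy
  obtain ⟨c, hc⟩ := Submodule.mem_span_singleton.1 (h (vsub_mem_vectorSpan ℝ hx hy))
  have : ⟪w, x - y⟫_ℝ = 0 := by rw [← vsub_eq_sub, ← hc, inner_smul_right, hw, mul_zero]
  rw [inner_sub_right] at this
  linarith

theorem finrank_span_singleton_le_one (u : E3) :
    Module.finrank ℝ (Submodule.span ℝ {u}) ≤ 1 := by
  simpa using finrank_span_le_card (R := ℝ) ({u} : Set E3)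

/-- The vectors exposing a subset of `A` that spans a line of direction `u`. -/
def edgeNormals (A : Set E3) (u : E3) : Set E3 :=
  {w | vectorSpan ℝ (face A w) = Submodule.span ℝ {u}}

/-- The vectors exposing a subset of `A` contained in a line. -/
def IsRegularNormal (A : Set E3) (w : E3) : Prop :=
  Module.finrank ℝ (vectorSpan ℝ (face A w)) ≤ 1

theorem inner_eq_zero_of_mem_edgeNormals {A : Set E3} {u w : E3} (h : w ∈ edgeNormals A u) :
    ⟪w, u⟫_ℝ = 0 := by
  apply inner_eq_zero_of_mem_vectorSpan_face (A := A)
  rw [show vectorSpan ℝ (face A w) = _ from h]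
  exact Submodule.mem_span_singleton_self u

theorem isRegularNormal_of_mem_edgeNormals {A : Set E3} {u w : E3} (h : w ∈ edgeNormals A u) :
    IsRegularNormal A w := by
  rw [IsRegularNormal, show vectorSpan ℝ (face A w) = _ from h]
  exact finrank_span_singleton_le_one u

theorem smul_mem_edgeNormals_iff {A : Set E3} {u w : E3} {c : ℝ} (hc : 0 < c) :
    c • w ∈ edgeNormals A u ↔ w ∈ edgeNormals A u := by
  simp only [edgeNormals, Set.mem_ofPred_eq, face_smul A hc]

theorem isRegularNormal_of_le_span {A : Set E3} {u w : E3}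
    (h : vectorSpan ℝ (face A w) ≤ Submodule.span ℝ {u}) : IsRegularNormal A w :=
  (Submodule.finrank_mono h).trans (finrank_span_singleton_le_one u)

/-- The direction of a collinear set is the line spanned by any non-zero vector in it. -/
theorem vectorSpan_eq_span_of_finrank_le_one {X : Set E3} {v : E3}
    (hX : Module.finrank ℝ (vectorSpan ℝ X) ≤ 1) (hv : v ≠ 0) (h : v ∈ vectorSpan ℝ X) :
    vectorSpan ℝ X = Submodule.span ℝ {v} := by
  symm
  apply Submodule.eq_of_le_of_finrank_le
  · rwa [Submodule.span_singleton_le_iff_mem]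
  · rwa [finrank_span_singleton hv]

theorem eq_bot_or_eq_span_of_le_span {W : Submodule ℝ E3} {u : E3}
    (h : W ≤ Submodule.span ℝ {u}) : W = ⊥ ∨ W = Submodule.span ℝ {u} := by
  by_cases hW : W = ⊥
  · exact Or.inl hW
  · right
    obtain ⟨v, hv, hv0⟩ := Submodule.exists_mem_ne_zero_of_ne_bot hW
    obtain ⟨c, rfl⟩ := Submodule.mem_span_singleton.1 (h hv)
    have hc : c ≠ 0 := by rintro rfl; simp at hv0
    apply le_antisymm h
    rw [Submodule.span_singleton_le_iff_mem]
    simpa [smul_smul, hc] using W.smul_mem c⁻¹ hv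

/-- Near an edge normal, and orthogonally to the edge, the exposed face does not change. -/
theorem eventually_face_eq_of_mem_edgeNormals {A : Set E3} (hA : A.Finite) (hne : A.Nonempty)
    {u w : E3} (hw : w ∈ edgeNormals A u) :
    ∀ᶠ v in 𝓝 w, ⟪v, u⟫_ℝ = 0 → face A v = face A w := by
  filter_upwards [eventually_face_eq hA hne w] with v hv h0
  rw [hv]
  exact face_eq_self_of_const
    (inner_eq_of_vectorSpan_le (le_of_eq (show vectorSpan ℝ (face A w) = _ from hw)) h0)

/-- Near `w` the exposed face can only shrink. If it still spans the direction `u` while the face at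
`w` is collinear, then the face at `w` has direction `u` already. Hence membership is locally
constant on the plane at regular vectors. -/
theorem eventually_mem_edgeNormals_iff {A : Set E3} (hA : A.Finite) (hne : A.Nonempty)
    {u w : E3} (hu : u ≠ 0) (hw : IsRegularNormal A w) :
    ∀ᶠ v in 𝓝 w, ⟪v, u⟫_ℝ = 0 → (v ∈ edgeNormals A u ↔ w ∈ edgeNormals A u) := by
  by_cases h : w ∈ edgeNormals A u
  · filter_upwards [eventually_face_eq_of_mem_edgeNormals hA hne h] with v hv h0
    rw [edgeNormals, Set.mem_ofPred_eq, hv h0, Set.mem_ofPred_eq]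
  · filter_upwards [eventually_face_subset hA w] with v hv _
    refine iff_of_false (fun hvG => h ?_) h
    apply vectorSpan_eq_span_of_finrank_le_one hw hu
    apply vectorSpan_mono ℝ hv
    rw [show vectorSpan ℝ (face A v) = _ from hvG]
    exact Submodule.mem_span_singleton_self u

/-- Both `n` and `m` are constant on the iterated face, so its directions are orthogonal to two
independent vectors of the plane `u^⊥`. -/
theorem vectorSpan_face_face_le {A : Set E3} {u n m : E3} (hu : u ≠ 0) (hnm : cross n m ≠ 0)
    (hn : ⟪n, u⟫_ℝ = 0) (hm : ⟪m, u⟫_ℝ = 0) :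
    vectorSpan ℝ (face (face A n) m) ≤ Submodule.span ℝ {u} := fun _ hz =>
  mem_span_of_orthogonal hu hnm hn hm
    (inner_eq_zero_of_mem_vectorSpan_face (vectorSpan_mono ℝ (face_subset _ _) hz))
    (inner_eq_zero_of_mem_vectorSpan_face hz)

/-! ### Faces of convex hulls -/

theorem isExposed_face (A : Set E3) (w : E3) : IsExposed ℝ A (face A w) :=
  fun _ => ⟨innerSL ℝ w, by ext x; simp [face]⟩

theorem convex_face {A : Set E3} (hA : Convex ℝ A) (w : E3) : Convex ℝ (face A w) :=
  (isExposed_face A w).convex hA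

theorem isLinearMap_inner (w : E3) : IsLinearMap ℝ fun x : E3 => ⟪w, x⟫_ℝ :=
  ⟨fun x y => inner_add_right w x y, fun c x => by rw [inner_smul_right]; rfl⟩

theorem inner_le_of_mem_convexHull {A : Set E3} {w : E3} {c : ℝ} (h : ∀ x ∈ A, ⟪w, x⟫_ℝ ≤ c) :
    ∀ x ∈ convexHull ℝ A, ⟪w, x⟫_ℝ ≤ c :=
  convexHull_min h (convex_halfSpace_le (isLinearMap_inner w) c)

theorem inner_lt_of_mem_convexHull {A : Set E3} {w : E3} {c : ℝ} (h : ∀ x ∈ A, ⟪w, x⟫_ℝ < c) :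
    ∀ x ∈ convexHull ℝ A, ⟪w, x⟫_ℝ < c :=
  convexHull_min h (convex_halfSpace_lt (isLinearMap_inner w) c)

/-- A point of the hull joins a point over the maximizers to a point over the rest. Any positive
weight on the rest makes the scalar product strictly smaller. -/
theorem face_convexHull {A : Set E3} (hA : A.Finite) (hne : A.Nonempty) (w : E3) :
    face (convexHull ℝ A) w = convexHull ℝ (face A w) := by
  obtain ⟨p, hp⟩ := face_nonempty hA hne w
  apply subset_antisymm
  · intro x hx
    have hxp : ⟪w, p⟫_ℝ ≤ ⟪w, x⟫_ℝ := hx.2 p (subset_convexHull ℝ A hp.1)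
    have hlt : ∀ y ∈ A \ face A w, ⟪w, y⟫_ℝ < ⟪w, p⟫_ℝ := by
      intro y hy
      refine lt_of_le_of_ne (hp.2 y hy.1) fun h => hy.2 ⟨hy.1, fun z hz => ?_⟩
      rw [h]; exact hp.2 z hz
    rcases (A \ face A w).eq_empty_or_nonempty with he | hne'
    · rw [← subset_antisymm (face_subset A w) (Set.sdiff_eq_empty.1 he)] at hx
      exact hx.1
    · have hxA := hx.1
      rw [← Set.union_sdiff_cancel (face_subset A w), convexHull_union ⟨p, hp⟩ hne',
        mem_convexJoin] at hxA
      obtain ⟨a, ha, b, hb, α, β, hα, hβ, hαβ, rfl⟩ := hxA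
      have h1 := inner_le_of_mem_convexHull (c := ⟪w, p⟫_ℝ) (fun y hy => hp.2 y hy.1) a ha
      have h2 := inner_lt_of_mem_convexHull hlt b hb
      rw [inner_add_right, inner_smul_right, inner_smul_right] at hxp
      have hβ0 : β = 0 := by
        by_contra hne0
        have hβpos : 0 < β := lt_of_le_of_ne hβ (Ne.symm hne0)
        have e1 : α * ⟪w, a⟫_ℝ ≤ α * ⟪w, p⟫_ℝ := mul_le_mul_of_nonneg_left h1 hα
        have e2 : β * ⟪w, b⟫_ℝ < β * ⟪w, p⟫_ℝ := mul_lt_mul_of_pos_left h2 hβpos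
        have e3 : α * ⟪w, p⟫_ℝ + β * ⟪w, p⟫_ℝ = ⟪w, p⟫_ℝ := by rw [← add_mul, hαβ, one_mul]
        linarith
      subst hβ0
      have hα1 : α = 1 := by linarith
      subst hα1
      simpa using ha
  · apply convexHull_min _ (convex_face (convex_convexHull ℝ A) w)
    intro x hx
    exact ⟨subset_convexHull ℝ A hx.1, fun y hy => inner_le_of_mem_convexHull hx.2 y hy⟩

theorem vectorSpan_convexHull (A : Set E3) : vectorSpan ℝ (convexHull ℝ A) = vectorSpan ℝ A := by
  rw [← direction_affineSpan, affineSpan_convexHull, direction_affineSpan]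

theorem vectorSpan_face_convexHull {A : Set E3} (hA : A.Finite) (hne : A.Nonempty) (w : E3) :
    vectorSpan ℝ (face (convexHull ℝ A) w) = vectorSpan ℝ (face A w) := by
  rw [face_convexHull hA hne, vectorSpan_convexHull]

/-! ### Vertices of planar polygons and their edges -/

/-- `b` is the last vertex, in the sense of rotation about `d`, of the edge of `T` exposed by
`v`. -/
def IsEdgeEnd (T : Set E3) (d v b : E3) : Prop :=
  b ∈ face (face T v) (cross d v) ∧ ∃ t ∈ face T v, t ≠ b

theorem eq_of_mem_face_face {T : Set E3} {d v b b' : E3} (hT : ∀ x ∈ T, ⟪x, d⟫_ℝ = 0)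
    (hd : d ≠ 0) (hv : v ≠ 0) (hvd : ⟪v, d⟫_ℝ = 0)
    (hb : b ∈ face (face T v) (cross d v)) (hb' : b' ∈ face (face T v) (cross d v)) :
    b = b' := by
  have h1 := inner_eq_of_mem_face hb.1 hb'.1
  have h2 := inner_eq_of_mem_face hb hb'
  have h3 : ⟪b - b', d⟫_ℝ = 0 := by
    rw [inner_sub_left, hT b hb.1.1, hT b' hb'.1.1, sub_zero]
  obtain ⟨α, β, h⟩ := exists_combination hd hv hvd h3
  rw [← sub_eq_zero, ← inner_self_eq_zero (𝕜 := ℝ)]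
  nth_rw 1 [h]
  rw [inner_add_left, real_inner_smul_left, real_inner_smul_left, inner_sub_right,
    inner_sub_right, h1, h2]
  ring

theorem mem_extremePoints_of_mem_face_face {T : Set E3} (hfin : T.Finite) {d v b : E3}
    (hT : ∀ x ∈ T, ⟪x, d⟫_ℝ = 0)
    (hd : d ≠ 0) (hv : v ≠ 0) (hvd : ⟪v, d⟫_ℝ = 0)
    (hb : b ∈ face (face T v) (cross d v)) : b ∈ (convexHull ℝ T).extremePoints ℝ := by
  have hs : face (face T v) (cross d v) = {b} :=
    subset_antisymm (fun x hx => eq_of_mem_face_face hT hd hv hvd hx hb)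
      (Set.singleton_subset_iff.2 hb)
  have h := face_convexHull (face_finite hfin v) ⟨b, hb.1⟩ (cross d v)
  rw [hs, convexHull_singleton, ← face_convexHull hfin ⟨b, hb.1.1⟩] at h
  rw [← isExtreme_singleton (𝕜 := ℝ), ← h]
  exact (isExposed_face _ _).isExtreme.trans (isExposed_face _ _).isExtreme

/-- Up to the factor `⟪v, v⟫`, the form `⟪cross x d, y⟫` is the determinant of the coordinates of
`x` and `y` along `v` and `cross v d`. Comparing slopes therefore amounts to finding its sign. -/
theorem inner_cross_mul (v x y d : E3) (h : ⟪v, d⟫_ℝ = 0) :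
    ⟪v, v⟫_ℝ * ⟪cross x d, y⟫_ℝ =
      ⟪v, x⟫_ℝ * ⟪cross v d, y⟫_ℝ - ⟪cross v d, x⟫_ℝ * ⟪v, y⟫_ℝ := by
  have e1 := inner_cross_cross v d v (cross y x)
  rw [cross_cross, inner_sub_right, inner_smul_right, inner_smul_right, real_inner_comm v d, h]
    at e1
  have e2 : ⟪d, cross y x⟫_ℝ = ⟪cross x d, y⟫_ℝ := by
    simp only [inner_eq_sum, cross_apply_zero, cross_apply_one, cross_apply_two]; ring
  rw [e2] at e1
  linarith

/-- Seen from the vertex `b`, all other points lie in an open half-plane. The extreme one in angle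
gives an edge ending at `b`. -/
theorem exists_isEdgeEnd {T : Set E3} (hfin : T.Finite) {d b : E3}
    (hT : ∀ x ∈ T, ⟪x, d⟫_ℝ = 0) (hd : d ≠ 0) (hnt : T.Nontrivial)
    (hb : b ∈ (convexHull ℝ T).extremePoints ℝ) :
    ∃ v, v ≠ 0 ∧ ⟪v, d⟫_ℝ = 0 ∧ IsEdgeEnd T d v b := by
  have hbT : b ∈ T := extremePoints_convexHull_subset hb
  have hb' : b ∉ convexHull ℝ (T \ {b}) := by
    have := ((convex_convexHull ℝ T).mem_extremePoints_iff_mem_sdiff_convexHull_sdiff.1 hb).2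
    exact fun h => this (convexHull_mono
      (Set.sdiff_subset_sdiff_left (subset_convexHull ℝ T)) h)
  obtain ⟨f, c, hf, hfb⟩ := geometric_hahn_banach_closed_point (convex_convexHull ℝ (T \ {b}))
    ((hfin.subset Set.sdiff_subset).isClosed_convexHull ℝ) hb'
  set w := (InnerProductSpace.toDual ℝ E3).symm f
  -- Since `T` is orthogonal to `d`, removing the component along `d` does not change the values on
  -- `T`.
  set v := w - (⟪w, d⟫_ℝ / ⟪d, d⟫_ℝ) • d
  have hdd : ⟪d, d⟫_ℝ ≠ 0 := inner_self_ne_zero.2 hd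
  have hvd : ⟪v, d⟫_ℝ = 0 := by
    simp only [v, inner_sub_left, real_inner_smul_left]; field_simp; ring
  have hpos : ∀ t ∈ T \ {b}, 0 < ⟪v, b - t⟫_ℝ := by
    intro t ht
    have h1 := hf t (subset_convexHull ℝ _ ht)
    have h2 : ⟪v, b - t⟫_ℝ = f b - f t := by
      simp only [v, inner_sub_left, inner_sub_right, real_inner_smul_left, w,
        InnerProductSpace.toDual_symm_apply, real_inner_comm _ d, hT b hbT, hT t ht.1]
      ring
    rw [h2]; linarith
  obtain ⟨t₁, ht₁, hne₁⟩ := hnt.exists_ne b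
  -- The quotient is the slope of `b - t` in the frame `v`, `cross v d`; its denominator is
  -- positive, so minimal slope means extreme angle.
  obtain ⟨s, hs, hmin⟩ := Set.exists_min_image (T \ {b})
    (fun t => ⟪cross v d, b - t⟫_ℝ / ⟪v, b - t⟫_ℝ) (hfin.subset Set.sdiff_subset)
    ⟨t₁, ht₁, hne₁⟩
  have hsb : b - s ≠ 0 := sub_ne_zero.2 fun h => hs.2 h.symm
  have hsd : ⟪b - s, d⟫_ℝ = 0 := by rw [inner_sub_left, hT b hbT, hT s hs.1, sub_zero]
  have hv0 : v ≠ 0 := by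
    intro h0
    have := hpos s hs
    simp [h0] at this
  have hvv : 0 < ⟪v, v⟫_ℝ := real_inner_self_pos.2 hv0
  have hu0 : cross (b - s) d ≠ 0 := cross_ne_zero_of_inner_eq_zero hsb hd hsd
  have hmax : ∀ t ∈ T, ⟪cross (b - s) d, t⟫_ℝ ≤ ⟪cross (b - s) d, b⟫_ℝ := by
    intro t ht
    by_cases htb : t = b
    · rw [htb]
    have h1 := hmin t ⟨ht, htb⟩
    rw [div_le_div_iff₀ (hpos s hs) (hpos t ⟨ht, htb⟩)] at h1
    have h2 := inner_cross_mul v (b - s) (b - t) d hvd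
    have h3 : 0 ≤ ⟪cross (b - s) d, b - t⟫_ℝ := by
      refine nonneg_of_mul_nonneg_right ?_ hvv
      rw [h2]; linarith
    rw [inner_sub_right] at h3
    linarith
  have hbf : b ∈ face T (cross (b - s) d) := ⟨hbT, hmax⟩
  refine ⟨cross (b - s) d, hu0, inner_cross_right _ _, ⟨hbf, fun t ht => ?_⟩, s, ⟨hs.1, ?_⟩,
    fun h => hs.2 h⟩
  -- Every other maximizer `t` satisfies `b - t = α • (b - s)` with `α ≥ 0`, so `b` is at the end of
  -- the edge selected by the rotation about `d`.
  · by_cases htb : t = b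
    · rw [htb]
    have h1 := inner_eq_of_mem_face ht hbf
    have h2 : ⟪b - t, d⟫_ℝ = 0 := by rw [inner_sub_left, hT b hbT, hT t ht.1, sub_zero]
    have h3 : ⟪cross (b - s) d, b - t⟫_ℝ = 0 := by rw [inner_sub_right, h1, sub_self]
    obtain ⟨α, β, h⟩ := exists_combination hd hsb hsd h2
    have hk : 0 < ⟪cross (b - s) d, cross (b - s) d⟫_ℝ := real_inner_self_pos.2 hu0
    have hβ : β = 0 := by
      rw [h, inner_add_right, inner_smul_right, inner_smul_right, inner_cross_left,
        cross_anticomm d, inner_neg_right] at h3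
      have : β * ⟪cross (b - s) d, cross (b - s) d⟫_ℝ = 0 := by linarith
      exact (mul_eq_zero.1 this).resolve_right hk.ne'
    have hα : 0 ≤ α := by
      have := hpos t ⟨ht.1, htb⟩
      rw [h, hβ, zero_smul, add_zero, inner_smul_right] at this
      exact (pos_of_mul_pos_left this (hpos s hs).le).le
    have h4 : ⟪cross d (cross (b - s) d), b - t⟫_ℝ
        = α * (⟪d, d⟫_ℝ * ⟪b - s, b - s⟫_ℝ) := by
      rw [h, hβ, zero_smul, add_zero, cross_cross, inner_sub_left, real_inner_smul_left,
        real_inner_smul_left, inner_smul_right, inner_smul_right, real_inner_comm (b - s) d, hsd]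
      ring
    have h5 : 0 ≤ ⟪cross d (cross (b - s) d), b - t⟫_ℝ := by
      rw [h4]
      exact mul_nonneg hα (mul_nonneg real_inner_self_nonneg real_inner_self_nonneg)
    rw [inner_sub_right] at h5
    linarith
  · intro t ht
    have : ⟪cross (b - s) d, b - s⟫_ℝ = 0 := inner_cross_left _ _
    rw [inner_sub_right] at this
    linarith [hmax t ht]

/-- The outer normal of an edge is recovered from its last vertex and another vertex on it. -/
theorem exists_eq_smul_cross_of_mem_face {T : Set E3} {d v b t : E3}
    (hT : ∀ x ∈ T, ⟪x, d⟫_ℝ = 0) (hd : d ≠ 0) (hv : v ≠ 0) (hvd : ⟪v, d⟫_ℝ = 0)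
    (hb : b ∈ face (face T v) (cross d v)) (ht : t ∈ face T v) (htb : t ≠ b) :
    ∃ c : ℝ, 0 < c ∧ v = c • cross (b - t) d := by
  have hx : b - t ≠ 0 := sub_ne_zero.2 htb.symm
  have hxd : ⟪b - t, d⟫_ℝ = 0 := by rw [inner_sub_left, hT b hb.1.1, hT t ht.1, sub_zero]
  have hu0 : cross (b - t) d ≠ 0 := cross_ne_zero_of_inner_eq_zero hx hd hxd
  have h1 : ⟪v, b - t⟫_ℝ = 0 := by
    rw [inner_sub_right, inner_eq_of_mem_face hb.1 ht, sub_self]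
  obtain ⟨c, hc⟩ := exists_smul_cross hu0 h1 hvd
  refine ⟨c, ?_, hc⟩
  have hc0 : c ≠ 0 := by rintro rfl; exact hv (by simpa using hc)
  have h2 : 0 ≤ ⟪cross d v, b - t⟫_ℝ := by
    rw [inner_sub_right]; linarith [hb.2 t ht]
  have h3 : ⟪cross d v, b - t⟫_ℝ = c * (⟪d, d⟫_ℝ * ⟪b - t, b - t⟫_ℝ) := by
    rw [hc, cross_smul_right, cross_cross, real_inner_smul_left, inner_sub_left,
      real_inner_smul_left, real_inner_smul_left, real_inner_comm (b - t) d, hxd]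
    ring
  have h4 : 0 < ⟪d, d⟫_ℝ * ⟪b - t, b - t⟫_ℝ :=
    mul_pos (real_inner_self_pos.2 hd) (real_inner_self_pos.2 hx)
  rw [h3] at h2
  exact lt_of_le_of_ne (nonneg_of_mul_nonneg_left h2 h4) hc0.symm

theorem IsEdgeEnd.exists_smul {T : Set E3} {d v v' b : E3}
    (hT : ∀ x ∈ T, ⟪x, d⟫_ℝ = 0) (hd : d ≠ 0) (hv : v ≠ 0) (hvd : ⟪v, d⟫_ℝ = 0)
    (hv' : v' ≠ 0) (hvd' : ⟪v', d⟫_ℝ = 0) (h : IsEdgeEnd T d v b) (h' : IsEdgeEnd T d v' b) :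
    ∃ c : ℝ, 0 < c ∧ v' = c • v := by
  obtain ⟨hb, t, ht, htb⟩ := h
  obtain ⟨hb', t', ht', htb'⟩ := h'
  have key : ∀ {w w' s s' : E3}, b ∈ face (face T w) (cross d w) →
      b ∈ face (face T w') (cross d w') → w ≠ 0 → ⟪w, d⟫_ℝ = 0 → s ∈ face T w → s ≠ b →
      s' ∈ face T w' → 0 ≤ ⟪cross (b - s) d, b - s'⟫_ℝ := by
    intro w w' s s' hw hw' hw0 hwd hs hsb hs'
    obtain ⟨c, hc, hcw⟩ := exists_eq_smul_cross_of_mem_face hT hd hw0 hwd hw hs hsb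
    have h1 : 0 ≤ ⟪w, b - s'⟫_ℝ := by
      rw [inner_sub_right]; linarith [hw.1.2 s' hs'.1]
    rw [hcw, real_inner_smul_left] at h1
    exact nonneg_of_mul_nonneg_right h1 hc
  have h1 := key hb hb' hv hvd ht htb ht'
  have h2 := key hb' hb hv' hvd' ht' htb' ht
  have h3 : ⟪cross (b - t') d, b - t⟫_ℝ = -⟪cross (b - t) d, b - t'⟫_ℝ := by
    simp only [inner_eq_sum, cross_apply_zero, cross_apply_one, cross_apply_two]; ring
  -- The two nonnegative quantities are opposite by antisymmetry, so they vanish and `t'` lies on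
  -- the edge exposed by `v`.
  have h4 : ⟪cross (b - t) d, b - t'⟫_ℝ = 0 := by linarith
  have ht'f : t' ∈ face T v := by
    obtain ⟨c, hc, hcv⟩ := exists_eq_smul_cross_of_mem_face hT hd hv hvd hb ht htb
    have h5 : ⟪v, b - t'⟫_ℝ = 0 := by rw [hcv, real_inner_smul_left, h4, mul_zero]
    rw [inner_sub_right] at h5
    exact ⟨ht'.1, fun y hy => by linarith [hb.1.2 y hy]⟩
  obtain ⟨c, hc, hcv⟩ := exists_eq_smul_cross_of_mem_face hT hd hv hvd hb ht'f htb'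
  obtain ⟨c', hc', hcv'⟩ := exists_eq_smul_cross_of_mem_face hT hd hv' hvd' hb' ht' htb'
  refine ⟨c' * c⁻¹, by positivity, ?_⟩
  rw [hcv, hcv', smul_smul]
  congr 1; field_simp

/-! ### Counting the vertices of a projection -/

open Classical in
/-- The number of vectors among `w` and `-w` that are edge normals of direction `u`. -/
noncomputable def edgeCount (A : Set E3) (u w : E3) : ℕ :=
  (if w ∈ edgeNormals A u then 1 else 0) + (if -w ∈ edgeNormals A u then 1 else 0)

theorem inner_starProjection {d v : E3} (h : ⟪v, d⟫_ℝ = 0) (x : E3) :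
    ⟪v, (Submodule.span ℝ {d})ᗮ.starProjection x⟫_ℝ = ⟪v, x⟫_ℝ := by
  rw [← Submodule.inner_starProjection_left_eq_right, Submodule.starProjection_eq_self_iff.2]
  rwa [Submodule.mem_orthogonal_singleton_iff_inner_left]

theorem inner_starProjection_self (d x : E3) :
    ⟪(Submodule.span ℝ {d})ᗮ.starProjection x, d⟫_ℝ = 0 :=
  Submodule.mem_orthogonal_singleton_iff_inner_left.1 (Submodule.starProjection_apply_mem _ x)

theorem sub_mem_span_of_starProjection_eq {d x y : E3}
    (h : (Submodule.span ℝ {d})ᗮ.starProjection x = (Submodule.span ℝ {d})ᗮ.starProjection y) :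
    x - y ∈ Submodule.span ℝ {d} := by
  have h0 : x - y ∈ ((Submodule.span ℝ {d})ᗮ.starProjection).ker := by
    rw [LinearMap.mem_ker]
    exact (map_sub (Submodule.span ℝ {d})ᗮ.starProjection x y).trans (sub_eq_zero.2 h)
  rwa [Submodule.ker_starProjection, Submodule.orthogonal_orthogonal] at h0

theorem starProjection_eq_of_sub_mem_span {d x y : E3} (h : x - y ∈ Submodule.span ℝ {d}) :
    (Submodule.span ℝ {d})ᗮ.starProjection x = (Submodule.span ℝ {d})ᗮ.starProjection y := by
  rw [← sub_eq_zero, ← map_sub]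
  have h0 : x - y ∈ ((Submodule.span ℝ {d})ᗮ.starProjection).ker := by
    rwa [Submodule.ker_starProjection, Submodule.orthogonal_orthogonal]
  exact LinearMap.mem_ker.1 h0

theorem face_image_starProjection (A : Set E3) {d v : E3} (h : ⟪v, d⟫_ℝ = 0) :
    face ((Submodule.span ℝ {d})ᗮ.starProjection '' A) v =
      (Submodule.span ℝ {d})ᗮ.starProjection '' face A v := by
  ext x
  constructor
  · rintro ⟨⟨a, ha, rfl⟩, hx⟩
    refine ⟨a, ⟨ha, fun y hy => ?_⟩, rfl⟩
    simpa only [inner_starProjection h] using hx _ ⟨y, hy, rfl⟩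
  · rintro ⟨a, ha, rfl⟩
    refine ⟨⟨a, ha.1, rfl⟩, ?_⟩
    rintro _ ⟨y, hy, rfl⟩
    simpa only [inner_starProjection h] using ha.2 y hy

/-- A direction of projection is generic when the edges of the projection come from edges. -/
def IsGenericDirection (A : Set E3) (d : E3) : Prop :=
  ∀ v, v ≠ 0 → ⟪v, d⟫_ℝ = 0 → IsRegularNormal A v

theorem zero_notMem_edgeNormals {A : Set E3} (hA : vectorSpan ℝ A = ⊤) (u : E3) :
    (0 : E3) ∉ edgeNormals A u := by
  intro h
  have h1 := isRegularNormal_of_mem_edgeNormals h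
  rw [IsRegularNormal, face_zero, hA, finrank_top, finrank_euclideanSpace_fin] at h1
  omega

/-- Each edge of the projection is matched with its last vertex in the sense of rotation about `d`.
The edges are indexed by a direction `u` and the sign of the outer normal along `cross u d`;
genericity of `d` ensures that every edge of the projection comes from a collinear face. -/
theorem encard_extremePoints_projAlong {A : Set E3} (hfin : A.Finite)
    (hA : vectorSpan ℝ A = ⊤) {d : E3} (hd : d ≠ 0) (hgen : IsGenericDirection A d)
    (U : Finset E3) (hU : ∀ u ∈ U, IsNormalized u)
    (hU' : ∀ u w, IsNormalized u → w ∈ edgeNormals A u → u ∈ U) :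
    ((projAlong d (convexHull ℝ A)).extremePoints ℝ).encard =
      ((∑ u ∈ U, edgeCount A u (cross u d) : ℕ) : ℕ∞) := by
  classical
  set p := (Submodule.span ℝ {d})ᗮ.starProjection with hp
  have hne : A.Nonempty := by
    rw [Set.nonempty_iff_ne_empty]; rintro rfl
    exact bot_ne_top ((vectorSpan_empty ℝ E3).symm.trans hA)
  set T := p '' A with hTdef
  have hTfin : T.Finite := hfin.image _
  have hTne : T.Nonempty := hne.image _
  have hT : ∀ x ∈ T, ⟪x, d⟫_ℝ = 0 := by
    rintro _ ⟨x, -, rfl⟩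
    exact inner_starProjection_self d x
  have hTnt : T.Nontrivial := by
    by_contra h
    rw [Set.not_nontrivial_iff] at h
    have hle : vectorSpan ℝ A ≤ Submodule.span ℝ {d} := by
      rw [vectorSpan_def, Submodule.span_le]
      rintro _ ⟨x, hx, y, hy, rfl⟩
      exact sub_mem_span_of_starProjection_eq (h ⟨x, hx, rfl⟩ ⟨y, hy, rfl⟩)
    have := (Submodule.finrank_mono hle).trans (finrank_span_singleton_le_one d)
    rw [hA, finrank_top, finrank_euclideanSpace_fin] at this
    omega
  have hproj : projAlong d (convexHull ℝ A) = convexHull ℝ T :=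
    LinearMap.image_convexHull (p : E3 →ₗ[ℝ] E3) A
  have hchoice : ∀ v, ∃ b, b ∈ face (face T v) (cross d v) := fun v =>
    face_nonempty (face_finite hTfin v) (face_nonempty hTfin hTne v) _
  choose b hb using hchoice
  set n : E3 × ℝ → E3 := fun q => q.2 • cross q.1 d
  set I := (U ×ˢ ({1, -1} : Finset ℝ)).filter fun q => n q ∈ edgeNormals A q.1 with hI
  have hn0 : ∀ q ∈ I, n q ≠ 0 := by
    intro q hq h0
    have := (Finset.mem_filter.1 hq).2
    rw [h0] at this
    exact zero_notMem_edgeNormals hA _ this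
  have hnd : ∀ q : E3 × ℝ, ⟪n q, d⟫_ℝ = 0 := by
    intro q
    rw [real_inner_smul_left, inner_cross_right, mul_zero]
  have hend : ∀ q ∈ I, IsEdgeEnd T d (n q) (b (n q)) := by
    intro q hq
    refine ⟨hb _, ?_⟩
    have hqG := (Finset.mem_filter.1 hq).2
    have hqU := hU q.1 (Finset.mem_product.1 (Finset.mem_filter.1 hq).1).1
    -- If the edge collapsed to a point, `u` would be parallel to `d`, and the normal, a multiple of
    -- `cross u d`, would vanish.
    by_contra! hall
    have hle : vectorSpan ℝ (face A (n q)) ≤ Submodule.span ℝ {d} := by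
      rw [vectorSpan_def, Submodule.span_le]
      rintro _ ⟨x, hx, y, hy, rfl⟩
      have hm : ∀ z ∈ face A (n q), p z = b (n q) := fun z hz =>
        hall _ (by rw [hTdef, hp, face_image_starProjection A (hnd q)]; exact ⟨z, hz, rfl⟩)
      exact sub_mem_span_of_starProjection_eq ((hm x hx).trans (hm y hy).symm)
    rw [show vectorSpan ℝ (face A (n q)) = _ from hqG, Submodule.span_singleton_le_iff_mem] at hle
    obtain ⟨c, hc⟩ := Submodule.mem_span_singleton.1 hle
    apply hn0 q hq
    simp only [n, ← hc, cross_smul_left, cross_self, smul_zero]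
  have hbij : Set.BijOn (fun q => b (n q)) (I : Set (E3 × ℝ))
      ((convexHull ℝ T).extremePoints ℝ) := by
    refine ⟨fun q hq => ?_, fun q hq r hr hqr => ?_, fun x hx => ?_⟩
    · exact mem_extremePoints_of_mem_face_face hTfin hT hd (hn0 q hq) (hnd q) (hb _)
    · have hq' := hend q hq
      have hr' := hend r hr
      dsimp only at hqr
      rw [← hqr] at hr'
      obtain ⟨c, hc, hcn⟩ := hq'.exists_smul hT hd (hn0 q hq) (hnd q) (hn0 r hr) (hnd r) hr'
      obtain ⟨hqm, hqG⟩ := Finset.mem_filter.1 (Finset.mem_coe.1 hq)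
      obtain ⟨hrm, hrG⟩ := Finset.mem_filter.1 (Finset.mem_coe.1 hr)
      obtain ⟨hq1, hq2⟩ := Finset.mem_product.1 hqm
      obtain ⟨hr1, hr2⟩ := Finset.mem_product.1 hrm
      have hqr1 : q.1 = r.1 := by
        apply (hU _ hq1).eq_of_mem_span (hU _ hr1)
        rw [hcn, smul_mem_edgeNormals_iff hc] at hrG
        rw [← show vectorSpan ℝ (face A (n q)) = _ from hrG,
          show vectorSpan ℝ (face A (n q)) = _ from hqG]
        exact Submodule.mem_span_singleton_self _
      refine Prod.ext hqr1 ?_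
      have hx0 : cross q.1 d ≠ 0 := by
        intro h0; apply hn0 q hq; simp only [n, h0, smul_zero]
      have h2 : r.2 = c * q.2 := by
        simp only [n, ← hqr1, smul_smul] at hcn
        exact smul_left_injective ℝ hx0 hcn
      simp only [Finset.mem_insert, Finset.mem_singleton] at hq2 hr2
      rcases hq2 with h | h <;> rcases hr2 with h' | h' <;> rw [h, h'] at h2 ⊢ <;> linarith
    · obtain ⟨v, hv0, hvd, hve⟩ := exists_isEdgeEnd hTfin hT hd hTnt hx
      obtain ⟨hxv, t, ht, htx⟩ := hve
      have hxv' := hxv.1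
      rw [hTdef, hp, face_image_starProjection A hvd] at ht hxv'
      obtain ⟨s, hs, rfl⟩ := ht
      obtain ⟨r, hr, hrx⟩ := hxv'
      have hsr : s - r ∉ Submodule.span ℝ {d} := fun h =>
        htx ((starProjection_eq_of_sub_mem_span h).trans hrx)
      have hsr0 : s - r ≠ 0 := fun h => hsr (h ▸ Submodule.zero_mem _)
      obtain ⟨u, hu, hus⟩ := exists_isNormalized hsr0
      have hvG : v ∈ edgeNormals A u := by
        rw [edgeNormals, Set.mem_ofPred_eq, ← hus]
        exact vectorSpan_eq_span_of_finrank_le_one (hgen v hv0 hvd) hsr0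
          (vsub_mem_vectorSpan ℝ hs hr)
      have hvu := inner_eq_zero_of_mem_edgeNormals hvG
      have hud : cross u d ≠ 0 := by
        intro h0
        rw [cross_anticomm, neg_eq_zero] at h0
        obtain ⟨c, hc⟩ := exists_smul_of_cross_eq_zero hd h0
        apply hsr
        have : s - r ∈ Submodule.span ℝ {u} := hus ▸ Submodule.mem_span_singleton_self _
        obtain ⟨e, he⟩ := Submodule.mem_span_singleton.1 this
        exact Submodule.mem_span_singleton.2 ⟨e * c, by rw [mul_smul, ← hc, he]⟩
      obtain ⟨c, hc⟩ := exists_smul_cross hud hvu hvd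
      have hc0 : c ≠ 0 := by rintro rfl; exact hv0 (by simpa using hc)
      have key : ∃ σ ∈ ({1, -1} : Finset ℝ), ∃ k : ℝ, 0 < k ∧ v = k • (σ • cross u d) := by
        rcases lt_or_gt_of_ne hc0 with h | h
        · exact ⟨-1, by simp, -c, by linarith, by rw [hc, smul_smul]; congr 1; ring⟩
        · exact ⟨1, by simp, c, h, by rw [hc, one_smul]⟩
      obtain ⟨σ, hσ, k, hk, hkv⟩ := key
      have hmem : (u, σ) ∈ I := by
        rw [hI, Finset.mem_filter, Finset.mem_product]
        refine ⟨⟨hU' u v hu hvG, hσ⟩, ?_⟩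
        rw [hkv, smul_mem_edgeNormals_iff hk] at hvG
        exact hvG
      refine ⟨(u, σ), hmem, ?_⟩
      have hfv : face (face T v) (cross d v)
          = face (face T (n (u, σ))) (cross d (n (u, σ))) := by
        rw [hkv, face_smul _ hk, cross_smul_right, face_smul _ hk]
      rw [hfv] at hxv
      exact eq_of_mem_face_face hT hd (hn0 _ hmem) (hnd _) (hb _) hxv
  rw [hproj, ← hbij.image_eq, hbij.injOn.encard_image, Set.encard_coe_eq_coe_finsetCard]
  congr 1
  rw [hI, Finset.card_filter, Finset.sum_product]
  refine Finset.sum_congr rfl fun u _ => ?_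
  rw [Finset.sum_pair (by norm_num)]
  simp only [n, edgeCount, one_smul, neg_smul]

/-! ### Balanced sets -/

/-- Both `w` and `-w` expose collinear faces. -/
def IsBiregular (A : Set E3) (w : E3) : Prop :=
  IsRegularNormal A w ∧ IsRegularNormal A (-w)

/-- For every direction `u`, the number of edge normals of direction `u` among `±w` is the same
for all generic `w` orthogonal to `u`. -/
def IsBalanced (A : Set E3) : Prop :=
  ∀ u, IsNormalized u → ∃ c : ℕ, ∀ w, ⟪w, u⟫_ℝ = 0 → IsBiregular A w → edgeCount A u w = c

open Classical in
/-- The indicator of the sets that span a line of direction `u`. -/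
noncomputable def lineIndicator (u : E3) (X : Set E3) : ℕ :=
  if vectorSpan ℝ X = Submodule.span ℝ {u} then 1 else 0

theorem edgeCount_eq (A : Set E3) (u w : E3) :
    edgeCount A u w = lineIndicator u (face A w) + lineIndicator u (face A (-w)) := rfl

theorem eventually_neg {p : E3 → Prop} {w : E3} (h : ∀ᶠ v in 𝓝 (-w), p v) :
    ∀ᶠ v in 𝓝 w, p (-v) :=
  (continuous_neg.tendsto w).eventually h

theorem tendsto_add_smul (w m : E3) :
    Tendsto (fun t : ℝ => w + t • m) (𝓝[>] 0) (𝓝 w) := by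
  have : Continuous fun t : ℝ => w + t • m := by fun_prop
  simpa using (this.tendsto 0).mono_left nhdsWithin_le_nhds

theorem eventually_edgeCount_eq {A : Set E3} (hfin : A.Finite) (hne : A.Nonempty) {u w : E3}
    (hu : u ≠ 0) (hw : IsBiregular A w) :
    ∀ᶠ v in 𝓝 w, ⟪v, u⟫_ℝ = 0 → edgeCount A u v = edgeCount A u w := by
  filter_upwards [eventually_mem_edgeNormals_iff hfin hne hu hw.1,
    eventually_neg (eventually_mem_edgeNormals_iff hfin hne hu hw.2)] with v h1 h2 hv
  have h2' := h2 (by rw [inner_neg_left, hv, neg_zero])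
  classical
  simp only [edgeCount, h1 hv, h2']

theorem cross_cross_self_ne_zero {u n : E3} (hu : u ≠ 0) (hn : n ≠ 0) (h : ⟪n, u⟫_ℝ = 0) :
    cross n (cross u n) ≠ 0 := by
  rw [cross_cross, h, zero_smul, sub_zero]
  exact smul_ne_zero (inner_self_ne_zero.2 hn) hu

theorem eventually_isBiregular {A : Set E3} (hfin : A.Finite) (hne : A.Nonempty) {u n : E3}
    (hu : u ≠ 0) (hn : n ≠ 0) (h : ⟪n, u⟫_ℝ = 0) :
    ∀ᶠ t in 𝓝[>] (0 : ℝ), IsBiregular A (n + t • cross u n) := by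
  filter_upwards [eventually_face_add_smul hfin hne n (cross u n),
    eventually_face_add_smul hfin hne (-n) (cross u (-n))] with t h1 h2
  have e : -(n + t • cross u n) = -n + t • cross u (-n) := by
    rw [← neg_one_smul ℝ n, cross_smul_right]; module
  refine ⟨isRegularNormal_of_le_span (u := u) ?_, isRegularNormal_of_le_span (u := u) ?_⟩
  · rw [h1]
    exact vectorSpan_face_face_le hu (cross_cross_self_ne_zero hu hn h) h (inner_cross_left _ _)
  · rw [e, h2]
    have h' : ⟪-n, u⟫_ℝ = 0 := by rw [inner_neg_left, h, neg_zero]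
    exact vectorSpan_face_face_le hu (cross_cross_self_ne_zero hu (neg_ne_zero.2 hn) h') h'
      (inner_cross_left _ _)

theorem inner_add_smul_cross {u n : E3} (h : ⟪n, u⟫_ℝ = 0) (t : ℝ) :
    ⟪n + t • cross u n, u⟫_ℝ = 0 := by
  rw [inner_add_left, real_inner_smul_left, inner_cross_left, h, mul_zero, add_zero]

theorem face_face_smul_self (A : Set E3) (a : E3) (r : ℝ) :
    face (face A a) (r • a) = face A a :=
  face_eq_self_of_const fun x hx y hy => by
    rw [real_inner_smul_left, real_inner_smul_left, inner_eq_of_mem_face hx hy]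

/-- The value of `edgeCount` on the side of `n` given by the vector `m`. -/
noncomputable def sideCount (A : Set E3) (u n m : E3) : ℕ :=
  lineIndicator u (face (face A n) m) + lineIndicator u (face (face A (-n)) (-m))

theorem eventually_edgeCount_eq_sideCount {A : Set E3} (hfin : A.Finite) (hne : A.Nonempty)
    (u n m : E3) :
    ∀ᶠ t in 𝓝[>] (0 : ℝ), edgeCount A u (n + t • m) = sideCount A u n m := by
  filter_upwards [eventually_face_add_smul hfin hne n m,
    eventually_face_add_smul hfin hne (-n) (-m)] with t h1 h2
  have e : -(n + t • m) = -n + t • (-m) := by module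
  rw [edgeCount_eq, e, h1, h2, sideCount]

/-- Near `n`, the faces exposed by `v` and `-v` depend only on the sign of the component of `v`
along `cross u n`. The two signs give equal counts by hypothesis. If the component is zero, `n` is
itself biregular and the count is locally constant there. -/
theorem eventually_edgeCount_eq_of_sideCount_eq {A : Set E3} (hfin : A.Finite) (hne : A.Nonempty)
    {u n : E3} (hu : u ≠ 0) (hn : n ≠ 0) (h : ⟪n, u⟫_ℝ = 0)
    (hside : sideCount A u n (cross u n) = sideCount A u n (-cross u n)) :
    ∀ᶠ v in 𝓝 n, ⟪v, u⟫_ℝ = 0 → IsBiregular A v →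
      edgeCount A u v = sideCount A u n (cross u n) := by
  filter_upwards [eventually_face_eq hfin hne n,
    eventually_neg (eventually_face_eq hfin hne (-n))] with v h1 h2 hv hreg
  obtain ⟨α, β, hαβ⟩ := exists_combination hu hn h hv
  have c1 : ∀ x ∈ face A n, ∀ y ∈ face A n, ⟪α • n, x⟫_ℝ = ⟪α • n, y⟫_ℝ := by
    intro x hx y hy
    rw [real_inner_smul_left, real_inner_smul_left, inner_eq_of_mem_face hx hy]
  have c2 : ∀ x ∈ face A (-n), ∀ y ∈ face A (-n), ⟪α • -n, x⟫_ℝ = ⟪α • -n, y⟫_ℝ := by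
    intro x hx y hy
    rw [real_inner_smul_left, real_inner_smul_left, inner_eq_of_mem_face hx hy]
  have hneg : -v = α • -n + β • -cross u n := by rw [hαβ]; module
  have f1 : face A v = face (face A n) (β • cross u n) := by
    rw [h1, hαβ, face_add_of_const c1]
  have f2 : face A (-v) = face (face A (-n)) (β • -cross u n) := by
    rw [h2, hneg, face_add_of_const c2]
  rcases lt_trichotomy β 0 with hβ | hβ | hβ
  · have e1 : β • cross u n = (-β) • -cross u n := by module
    have e2 : β • -cross u n = (-β) • -(-cross u n) := by module
    rw [edgeCount_eq, f1, f2, e1, e2, face_smul _ (neg_pos.2 hβ), face_smul _ (neg_pos.2 hβ),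
      hside, sideCount]
  · rw [hβ, zero_smul, face_zero] at f1 f2
    have hb : IsBiregular A n := by
      rw [IsBiregular, IsRegularNormal, IsRegularNormal, f1, f2] at hreg
      exact hreg
    have hev := (tendsto_add_smul n (cross u n)).eventually
      (eventually_edgeCount_eq hfin hne hu hb)
    obtain ⟨t, ht1, ht2⟩ :=
      (hev.and (eventually_edgeCount_eq_sideCount hfin hne u n (cross u n))).exists
    rw [← ht2, ht1 (inner_add_smul_cross h t), edgeCount_eq, edgeCount_eq, f1, f2]
  · rw [edgeCount_eq, f1, f2, face_smul _ hβ, face_smul _ hβ, sideCount]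

theorem isPreconnected_punctured_plane (u : E3) :
    IsPreconnected {w : E3 | ⟪w, u⟫_ℝ = 0 ∧ w ≠ 0} := by
  have hrank : 1 < Module.rank ℝ (Submodule.span ℝ {u})ᗮ := by
    apply Module.lt_rank_of_lt_finrank
    have h1 := Submodule.finrank_add_finrank_orthogonal (Submodule.span ℝ {u})
    rw [finrank_euclideanSpace_fin] at h1
    have h2 := finrank_span_singleton_le_one u
    omega
  have h := (isConnected_compl_singleton_of_one_lt_rank hrank 0).isPreconnected.image
    Subtype.val continuous_subtype_val.continuousOn
  convert h using 1
  ext w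
  constructor
  · intro hw
    exact ⟨⟨w, Submodule.mem_orthogonal_singleton_iff_inner_left.2 hw.1⟩,
      fun h0 => hw.2 (congrArg Subtype.val h0), rfl⟩
  · rintro ⟨⟨x, hx⟩, h0, rfl⟩
    exact ⟨Submodule.mem_orthogonal_singleton_iff_inner_left.1 hx,
      fun hx0 => h0 (Subtype.ext hx0)⟩

theorem exists_edgeCount_eq {A : Set E3} (hfin : A.Finite) (hne : A.Nonempty)
    {u : E3} (hu : u ≠ 0)
    (hside : ∀ n, n ≠ 0 → ⟪n, u⟫_ℝ = 0 →
      sideCount A u n (cross u n) = sideCount A u n (-cross u n)) :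
    ∃ c : ℕ, ∀ w, w ≠ 0 → ⟪w, u⟫_ℝ = 0 → IsBiregular A w → edgeCount A u w = c := by
  -- The count is controlled only at biregular vectors. `L x c` says that `c` is its value near `x`,
  -- which makes sense at every nonzero `x` of the plane, since biregular vectors accumulate there.
  set L : E3 → ℕ → Prop := fun x c =>
    ∀ᶠ v in 𝓝 x, ⟪v, u⟫_ℝ = 0 → IsBiregular A v → edgeCount A u v = c with hL
  have hex : ∀ x, x ≠ 0 → ⟪x, u⟫_ℝ = 0 → ∃ c, L x c := fun x hx0 hx =>
    ⟨_, eventually_edgeCount_eq_of_sideCount_eq hfin hne hu hx0 hx (hside x hx0 hx)⟩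
  have huniq : ∀ x, x ≠ 0 → ⟪x, u⟫_ℝ = 0 → ∀ c c', L x c → L x c' → c = c' := by
    intro x hx0 hx c c' hc hc'
    have ht := tendsto_add_smul x (cross u x)
    obtain ⟨t, h1, h2, h3⟩ := ((ht.eventually hc).and ((ht.eventually hc').and
      (eventually_isBiregular hfin hne hu hx0 hx))).exists
    rw [← h1 (inner_add_smul_cross hx t) h3, h2 (inner_add_smul_cross hx t) h3]
  by_cases hW : ∃ w, w ≠ 0 ∧ ⟪w, u⟫_ℝ = 0
  · obtain ⟨w₀, hw₀, hw₀u⟩ := hW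
    obtain ⟨c, hc⟩ := hex w₀ hw₀ hw₀u
    refine ⟨c, fun w hw hwu hreg => ?_⟩
    have key := (isPreconnected_punctured_plane u).induction₂ (fun x y => ∃ c, L x c ∧ L y c)
      (fun x hx => by
        obtain ⟨c, hc⟩ := hex x hx.2 hx.1
        filter_upwards [nhdsWithin_le_nhds (eventually_eventually_nhds.2 hc)] with y hy
        exact ⟨c, hc, hy⟩)
      (fun x y z hx hy hz ⟨c, h1, h2⟩ ⟨c', h3, h4⟩ => by
        rw [huniq y hy.2 hy.1 c' c h3 h2] at h4
        exact ⟨c, h1, h4⟩)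
      (fun x y _ _ ⟨c, h1, h2⟩ => ⟨c, h2, h1⟩)
      (x := w₀) (y := w) ⟨hw₀u, hw₀⟩ ⟨hwu, hw⟩
    obtain ⟨c', h1, h2⟩ := key
    rw [huniq w₀ hw₀ hw₀u c c' hc h1]
    exact h2.self_of_nhds hwu hreg
  · exact ⟨0, fun w hw hwu _ => absurd ⟨w, hw, hwu⟩ hW⟩

theorem nonempty_of_vectorSpan_eq_top {A : Set E3} (hA : vectorSpan ℝ A = ⊤) : A.Nonempty := by
  rw [Set.nonempty_iff_ne_empty]; rintro rfl
  exact bot_ne_top ((vectorSpan_empty ℝ E3).symm.trans hA)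

theorem eq_zero_of_const {A : Set E3} (hA : vectorSpan ℝ A = ⊤) {w : E3}
    (h : ∀ x ∈ A, ∀ y ∈ A, ⟪w, x⟫_ℝ = ⟪w, y⟫_ℝ) : w = 0 := by
  have : ⟪w, w⟫_ℝ = 0 := inner_eq_zero_of_mem_vectorSpan h (hA ▸ Submodule.mem_top)
  exact inner_self_eq_zero.1 this

theorem not_isRegularNormal_zero {A : Set E3} (hA : vectorSpan ℝ A = ⊤) :
    ¬ IsRegularNormal A 0 := by
  intro h
  rw [IsRegularNormal, face_zero, hA, finrank_top, finrank_euclideanSpace_fin] at h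
  omega

/-- Every edge of a 3-dimensional polytope is parallel to a facet. -/
theorem notMem_edgeNormals_of_isGenericDirection {A : Set E3} (hfin : A.Finite)
    (hA : vectorSpan ℝ A = ⊤) {u : E3} (hu : u ≠ 0) (hgen : IsGenericDirection A u) (w : E3) :
    w ∉ edgeNormals A u := by
  have hne := nonempty_of_vectorSpan_eq_top hA
  intro hw
  have hw0 : w ≠ 0 := by rintro rfl; exact zero_notMem_edgeNormals hA u hw
  have hwu := inner_eq_zero_of_mem_edgeNormals hw
  -- Genericity makes every nonzero vector orthogonal to `u` regular, so the exposed face stays the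
  -- same all the way from `w` to `-w`. Then `w` is both maximal and minimal on it, hence constant
  -- on `A`.
  have key := (isPreconnected_punctured_plane u).induction₂
    (fun x y => (x ∈ edgeNormals A u ↔ y ∈ edgeNormals A u) ∧
      (x ∈ edgeNormals A u → face A x = face A y))
    (fun x hx => by
      rw [eventually_nhdsWithin_iff]
      have hreg := hgen x hx.2 hx.1
      by_cases hxG : x ∈ edgeNormals A u
      · filter_upwards [eventually_mem_edgeNormals_iff hfin hne hu hreg,
          eventually_face_eq_of_mem_edgeNormals hfin hne hxG] with y h1 h2 hy
        exact ⟨(h1 hy.1).symm, fun _ => (h2 hy.1).symm⟩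
      · filter_upwards [eventually_mem_edgeNormals_iff hfin hne hu hreg] with y h1 hy
        exact ⟨(h1 hy.1).symm, fun h => absurd h hxG⟩)
    (fun x y z _ _ _ h1 h2 => ⟨h1.1.trans h2.1, fun h => (h1.2 h).trans (h2.2 (h1.1.1 h))⟩)
    (fun x y _ _ h => ⟨h.1.symm, fun hy => (h.2 (h.1.2 hy)).symm⟩)
    (x := w) (y := -w) ⟨hwu, hw0⟩ ⟨by rw [inner_neg_left, hwu, neg_zero], neg_ne_zero.2 hw0⟩
  have hf := key.2 hw
  apply hw0
  apply eq_zero_of_const hA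
  have hle : ∀ z ∈ face A w, ∀ x ∈ A, ⟪w, x⟫_ℝ = ⟪w, z⟫_ℝ := by
    intro z hz x hx
    have h2 := hz.2 x hx
    rw [hf] at hz
    have h3 := hz.2 x hx
    rw [inner_neg_left, inner_neg_left] at h3
    linarith
  obtain ⟨z, hz⟩ := face_nonempty hfin hne w
  intro x hx y hy
  rw [hle z hz x hx, hle z hz y hy]

theorem exists_ne_of_vectorSpan_eq {X : Set E3} {u : E3} (hu : u ≠ 0)
    (h : vectorSpan ℝ X = Submodule.span ℝ {u}) : X.Nontrivial := by
  by_contra hX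
  rw [Set.not_nontrivial_iff] at hX
  rw [vectorSpan_of_subsingleton ℝ hX] at h
  exact hu (Submodule.span_singleton_eq_bot.1 h.symm)

theorem finite_setOf_edgeNormals_nonempty {A : Set E3} (hfin : A.Finite) :
    {u | IsNormalized u ∧ (edgeNormals A u).Nonempty}.Finite := by
  have hν : ∀ v : E3, ∃ u, v ≠ 0 →
      IsNormalized u ∧ Submodule.span ℝ {v} = Submodule.span ℝ {u} := by
    intro v
    by_cases hv : v = 0
    · exact ⟨0, fun h => absurd hv h⟩
    · obtain ⟨u, hu⟩ := exists_isNormalized hv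
      exact ⟨u, fun _ => hu⟩
  choose ν hν using hν
  apply ((hfin.prod hfin).image fun q : E3 × E3 => ν (q.1 - q.2)).subset
  rintro u ⟨hu, w, hw⟩
  obtain ⟨x, hx, y, hy, hxy⟩ := exists_ne_of_vectorSpan_eq hu.ne_zero hw
  refine ⟨(x, y), ⟨hx.1, hy.1⟩, ?_⟩
  obtain ⟨h1, h2⟩ := hν (x - y) (sub_ne_zero.2 hxy)
  apply h1.eq_of_mem_span hu
  have h3 : Submodule.span ℝ {x - y} ≤ Submodule.span ℝ {u} := by
    rw [Submodule.span_singleton_le_iff_mem, ← show vectorSpan ℝ (face A w) = _ from hw]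
    exact vsub_mem_vectorSpan ℝ hx hy
  exact h3 (h2 ▸ Submodule.mem_span_singleton_self _)

/-! ### Facets and generic directions -/

theorem isFace_iff_exists_face {A : Set E3} (hfin : A.Finite) (hne : A.Nonempty) {F : Set E3} :
    IsFace (convexHull ℝ A) F ↔ ∃ w, F = face (convexHull ℝ A) w := by
  constructor
  · rintro ⟨hF, hexp⟩
    obtain ⟨l, hl⟩ := hexp hF
    refine ⟨(InnerProductSpace.toDual ℝ E3).symm l, ?_⟩
    rw [hl]
    ext x
    simp only [face, Set.mem_ofPred_eq, InnerProductSpace.toDual_symm_apply]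
  · rintro ⟨w, rfl⟩
    refine ⟨?_, isExposed_face _ _⟩
    rw [face_convexHull hfin hne]
    exact (face_nonempty hfin hne w).convexHull

theorem finrank_orthogonal_span_singleton_eq_two {v : E3} (hv : v ≠ 0) :
    Module.finrank ℝ (Submodule.span ℝ {v})ᗮ = 2 := by
  have h1 := Submodule.finrank_add_finrank_orthogonal (Submodule.span ℝ {v})
  rw [finrank_euclideanSpace_fin, finrank_span_singleton hv] at h1
  omega

/-- For `v ≠ 0`, a non-collinear face exposed by `v` has the whole plane `v^⊥` as its direction, so
`d` is parallel to it exactly when `d` is orthogonal to `v`. -/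
theorem forall_isFacet_iff_isGenericDirection {A : Set E3} (hfin : A.Finite)
    (hA : vectorSpan ℝ A = ⊤) (d : E3) :
    (∀ F, IsFacet (convexHull ℝ A) F → d ∉ vectorSpan ℝ F) ↔ IsGenericDirection A d := by
  have hne := nonempty_of_vectorSpan_eq_top hA
  constructor
  · intro h v hv hvd
    by_contra hreg
    rw [IsRegularNormal, not_le, ← vectorSpan_face_convexHull hfin hne] at hreg
    have hle : vectorSpan ℝ (face (convexHull ℝ A) v) ≤ (Submodule.span ℝ {v})ᗮ := fun z hz =>
      Submodule.mem_orthogonal_singleton_iff_inner_right.2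
        (inner_eq_zero_of_mem_vectorSpan_face hz)
    have h2 := finrank_orthogonal_span_singleton_eq_two hv
    have h3 := Submodule.finrank_mono hle
    refine h _ ⟨(isFace_iff_exists_face hfin hne).2 ⟨v, rfl⟩, ?_⟩ ?_
    · rw [dim]; omega
    · rw [Submodule.eq_of_le_of_finrank_le hle (by omega)]
      exact Submodule.mem_orthogonal_singleton_iff_inner_right.2 hvd
  · rintro h F ⟨hF, hdim⟩ hd
    obtain ⟨v, rfl⟩ := (isFace_iff_exists_face hfin hne).1 hF
    rw [dim, vectorSpan_face_convexHull hfin hne] at hdim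
    by_cases hv : v = 0
    · rw [hv, face_zero, hA, finrank_top, finrank_euclideanSpace_fin] at hdim
      omega
    · have := h v hv (inner_eq_zero_of_mem_vectorSpan_face hd)
      rw [IsRegularNormal, hdim] at this
      omega

theorem exists_ne_zero_inner_eq_zero (u : E3) : ∃ n : E3, n ≠ 0 ∧ ⟪n, u⟫_ℝ = 0 := by
  have h1 := Submodule.finrank_add_finrank_orthogonal (Submodule.span ℝ {u})
  rw [finrank_euclideanSpace_fin] at h1
  have h2 := finrank_span_singleton_le_one u
  have h3 : (Submodule.span ℝ {u})ᗮ ≠ ⊥ := by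
    intro h
    rw [h, finrank_bot] at h1
    omega
  obtain ⟨n, hn, hn0⟩ := Submodule.exists_mem_ne_zero_of_ne_bot h3
  exact ⟨n, hn0, Submodule.mem_orthogonal_singleton_iff_inner_left.1 hn⟩

theorem edgeCount_eq_zero {A : Set E3} {u w : E3} (h : w ∉ edgeNormals A u)
    (h' : -w ∉ edgeNormals A u) : edgeCount A u w = 0 := by
  simp [edgeCount, h, h']

theorem dim_convexHull_eq_three_iff {A : Set E3} :
    dim (convexHull ℝ A) = 3 ↔ vectorSpan ℝ A = ⊤ := by
  rw [dim, vectorSpan_convexHull]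
  constructor
  · intro h
    apply Submodule.eq_top_of_finrank_eq
    rw [h, finrank_euclideanSpace_fin]
  · intro h
    rw [h, finrank_top, finrank_euclideanSpace_fin]

theorem IsBalanced.isEquiprojective {S : Finset E3}
    (hS : vectorSpan ℝ (S : Set E3) = ⊤) (h : IsBalanced (S : Set E3)) :
    IsEquiprojective (convexHull ℝ (S : Set E3)) := by
  have hfin := S.finite_toSet
  have hne := nonempty_of_vectorSpan_eq_top hS
  have hU := finite_setOf_edgeNormals_nonempty hfin
  have hc : ∀ u, ∃ c : ℕ, IsNormalized u → ∀ w, ⟪w, u⟫_ℝ = 0 → IsBiregular (S : Set E3) w →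
      edgeCount (S : Set E3) u w = c := by
    intro u
    by_cases hu : IsNormalized u
    · obtain ⟨c, hc⟩ := h u hu
      exact ⟨c, fun _ => hc⟩
    · exact ⟨0, fun h => absurd h hu⟩
  choose c hc using hc
  refine ⟨∑ u ∈ hU.toFinset, c u, ⟨S, hne, rfl⟩, dim_convexHull_eq_three_iff.2 hS, ?_⟩
  intro d hd hfacet
  have hgen := (forall_isFacet_iff_isGenericDirection hfin hS d).1 hfacet
  rw [encard_extremePoints_projAlong hfin hS hd hgen hU.toFinset
    (fun u hu => (hU.mem_toFinset.1 hu).1) (fun u w hu hw => hU.mem_toFinset.2 ⟨hu, w, hw⟩)]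
  congr 1
  refine Finset.sum_congr rfl fun u hu => ?_
  have hun := (hU.mem_toFinset.1 hu).1
  -- If `d` is parallel to `u`, then `cross u d = 0` is not a generic vector. In that case there is
  -- no edge of direction `u`, and both the count and the constant are zero.
  by_cases h0 : cross u d = 0
  · obtain ⟨r, rfl⟩ := exists_smul_of_cross_eq_zero hun.ne_zero h0
    have hr : r ≠ 0 := by rintro rfl; simp at hd
    have hgen' : IsGenericDirection (S : Set E3) u := fun v hv hvu =>
      hgen v hv (by rw [inner_smul_right, hvu, mul_zero])
    have hno := notMem_edgeNormals_of_isGenericDirection hfin hS hun.ne_zero hgen'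
    obtain ⟨n, hn, hnu⟩ := exists_ne_zero_inner_eq_zero u
    rw [edgeCount_eq_zero (hno _) (hno _), ← hc u hun n hnu ⟨hgen' n hn hnu,
      hgen' (-n) (neg_ne_zero.2 hn) (by rw [inner_neg_left, hnu, neg_zero])⟩,
      edgeCount_eq_zero (hno _) (hno _)]
  · refine hc u hun _ (inner_cross_left _ _) ⟨hgen _ h0 (inner_cross_right _ _),
      hgen _ (neg_ne_zero.2 h0) ?_⟩
    rw [inner_neg_left, inner_cross_right, neg_zero]

/-! ### Equiprojective polytopes are balanced -/

theorem eventually_quadratic_ne_zero {a b c : ℝ} (h : ¬ (a = 0 ∧ b = 0 ∧ c = 0)) :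
    ∀ᶠ t in 𝓝[>] (0 : ℝ), a + t * b + t ^ 2 * c ≠ 0 := by
  have hlin : ∀ a b c : ℝ, a ≠ 0 → ∀ᶠ t in 𝓝[>] (0 : ℝ), a + t * b + t ^ 2 * c ≠ 0 := by
    intro a b c ha
    have : Continuous fun t : ℝ => a + t * b + t ^ 2 * c := by fun_prop
    exact ((this.tendsto 0).mono_left nhdsWithin_le_nhds).eventually_ne (by simpa using ha)
  by_cases ha : a = 0
  · by_cases hb : b = 0
    · have hc : c ≠ 0 := fun hc => h ⟨ha, hb, hc⟩
      filter_upwards [self_mem_nhdsWithin] with t ht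
      have : t ≠ 0 := ne_of_gt ht
      simp [ha, hb, hc, this]
    · filter_upwards [self_mem_nhdsWithin, hlin b c 0 hb] with t ht h1
      have h2 : t ≠ 0 := ne_of_gt ht
      have : a + t * b + t ^ 2 * c = t * (b + t * c + t ^ 2 * 0) := by rw [ha]; ring
      rw [this]
      exact mul_ne_zero h2 h1
  · exact hlin a b c ha

theorem exists_cross_ne_zero {X : Set E3} (h : 1 < Module.finrank ℝ (vectorSpan ℝ X)) :
    ∃ x ∈ X, ∃ y ∈ X, ∃ z ∈ X, cross (y - x) (z - x) ≠ 0 := by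
  by_contra! hall
  rcases X.eq_empty_or_nonempty with rfl | ⟨x, hx⟩
  · rw [vectorSpan_empty, finrank_bot] at h; omega
  have key : ∀ v, (∀ z ∈ X, z - x ∈ Submodule.span ℝ {v}) → False := by
    intro v hv
    have hle : vectorSpan ℝ X ≤ Submodule.span ℝ {v} := by
      rw [vectorSpan_eq_span_vsub_set_right ℝ hx, Submodule.span_le]
      rintro _ ⟨z, hz, rfl⟩
      exact hv z hz
    have := (Submodule.finrank_mono hle).trans (finrank_span_singleton_le_one v)
    omega
  by_cases hsub : ∀ z ∈ X, z = x
  · exact key 0 fun z hz => by rw [hsub z hz, sub_self]; exact Submodule.zero_mem _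
  · push Not at hsub
    obtain ⟨y, hy, hyx⟩ := hsub
    refine key (y - x) fun z hz => ?_
    obtain ⟨c, hc⟩ := exists_smul_of_cross_eq_zero (sub_ne_zero.2 hyx) (hall x hx y hy z hz)
    exact Submodule.mem_span_singleton.2 ⟨c, hc.symm⟩

/-- A non-collinear face contains three affinely independent points, which determine its normal up
to a factor. Genericity thus follows from finitely many linear conditions on `d`. -/
theorem isGenericDirection_of_forall_cross {A : Set E3} {d : E3}
    (h : ∀ x ∈ A, ∀ y ∈ A, ∀ z ∈ A, cross (y - x) (z - x) ≠ 0 →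
      ⟪cross (y - x) (z - x), d⟫_ℝ ≠ 0) : IsGenericDirection A d := by
  intro v hv hvd
  by_contra hreg
  obtain ⟨x, hx, y, hy, z, hz, hne⟩ := exists_cross_ne_zero (not_le.1 hreg)
  obtain ⟨c, rfl⟩ := exists_smul_cross (v := v) hne
    (by rw [inner_sub_right, inner_eq_of_mem_face hx hy, sub_self])
    (by rw [inner_sub_right, inner_eq_of_mem_face hx hz, sub_self])
  rw [real_inner_smul_left] at hvd
  rcases mul_eq_zero.1 hvd with h0 | h0
  · exact hv (by rw [h0, zero_smul])
  · exact h x hx.1 y hy.1 z hz.1 hne h0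

theorem cross_cross_cross (u a b : E3) :
    cross (cross u a) (cross u b) = ⟪cross a b, u⟫_ℝ • u := by
  ext i; fin_cases i <;> simp [cross, inner_eq_sum] <;> ring

/-- The value of `edgeCount` along a curve of second order. -/
noncomputable def curveCount (A : Set E3) (u a b c : E3) : ℕ :=
  lineIndicator u (face (face (face A a) b) c) +
    lineIndicator u (face (face (face A (-a)) (-b)) (-c))

theorem eventually_edgeCount_eq_curveCount {A : Set E3} (hfin : A.Finite) (hne : A.Nonempty)
    (u a b c : E3) :
    ∀ᶠ t in 𝓝[>] (0 : ℝ), edgeCount A u (a + t • b + t ^ 2 • c) = curveCount A u a b c := by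
  filter_upwards [eventually_face_add_smul_sq hfin hne a b c,
    eventually_face_add_smul_sq hfin hne (-a) (-b) (-c)] with t h1 h2
  have e : -(a + t • b + t ^ 2 • c) = -a + t • (-b) + t ^ 2 • (-c) := by module
  rw [edgeCount_eq, e, h1, h2, curveCount]

/-- If `u` is not orthogonal to `n`, the first two vectors are independent and cut out a face
contained in a line parallel to `u`, so the sign of the third is irrelevant. If `u` is orthogonal to
`n`, the second is a multiple of the first, so its sign is irrelevant. Either way the alternating
sum over the signs vanishes. -/
theorem curveCount_exchange (A : Set E3) {u u₀ n : E3} (hu : IsNormalized u)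
    (hu₀ : IsNormalized u₀) (hne : u ≠ u₀) (hnu : ⟪n, u₀⟫_ℝ = 0) :
    curveCount A u (cross u u₀) (cross u (cross n u₀)) (cross u n) +
      curveCount A u (cross u u₀) (-cross u (cross n u₀)) (-cross u n) =
    curveCount A u (cross u u₀) (cross u (cross n u₀)) (-cross u n) +
      curveCount A u (cross u u₀) (-cross u (cross n u₀)) (cross u n) := by
  have ha : cross u u₀ ≠ 0 := by
    intro h0
    rw [cross_anticomm, neg_eq_zero] at h0
    obtain ⟨r, hr⟩ := exists_smul_of_cross_eq_zero hu₀.ne_zero h0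
    exact hne (hu.eq_of_mem_span hu₀ (Submodule.mem_span_singleton.2 ⟨r, hr.symm⟩))
  by_cases hun : ⟪u, n⟫_ℝ = 0
  · have hz : cross u (cross n u₀) = ⟪u, u₀⟫_ℝ • n := by
      rw [cross_cross, hun, zero_smul, sub_zero]
    obtain ⟨r, hr⟩ := exists_smul_cross ha (v := n) (by rw [real_inner_comm, hun]) hnu
    have e1 : cross u (cross n u₀) = (⟪u, u₀⟫_ℝ * r) • cross u u₀ := by
      rw [hz, mul_smul, ← hr]
    set k := ⟪u, u₀⟫_ℝ * r
    have f1 := face_face_smul_self A (cross u u₀) k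
    have f2 := face_face_smul_self A (cross u u₀) (-k)
    have f3 := face_face_smul_self A (-cross u u₀) (-k)
    have f4 := face_face_smul_self A (-cross u u₀) k
    simp only [neg_smul, smul_neg, neg_neg] at f2 f3 f4
    simp only [curveCount, e1, neg_neg, f1, f2, f3, f4]
    rw [add_comm]
  · have hab : ∀ s s' : ℝ, s ≠ 0 → s' ≠ 0 →
        cross (s • cross u u₀) (s' • cross u (cross n u₀)) ≠ 0 := by
      intro s s' hs hs'
      rw [cross_smul_left, cross_smul_right, cross_cross_cross, cross_cross,
        real_inner_self_eq_norm_sq, hu₀.1, real_inner_comm n u₀, hnu]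
      refine smul_ne_zero hs (smul_ne_zero hs' (smul_ne_zero ?_ hu.ne_zero))
      rw [real_inner_comm] at hun
      simpa using hun
    have hconst : ∀ s s' r : ℝ, s ≠ 0 → s' ≠ 0 →
        face (face (face A (s • cross u u₀)) (s' • cross u (cross n u₀))) (r • cross u n) =
          face (face A (s • cross u u₀)) (s' • cross u (cross n u₀)) := by
      intro s s' r hs hs'
      apply face_eq_self_of_const
      apply inner_eq_of_vectorSpan_le (vectorSpan_face_face_le hu.ne_zero (hab s s' hs hs') _ _)
      all_goals rw [real_inner_smul_left, inner_cross_left, mul_zero]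
    have h1p := hconst 1 1 1
    have h1m := hconst 1 1 (-1)
    have h2p := hconst 1 (-1) 1
    have h2m := hconst 1 (-1) (-1)
    have h3p := hconst (-1) 1 1
    have h3m := hconst (-1) 1 (-1)
    have h4p := hconst (-1) (-1) 1
    have h4m := hconst (-1) (-1) (-1)
    simp only [one_smul, neg_smul, ne_eq, one_ne_zero, not_false_eq_true, neg_eq_zero,
      forall_const] at h1p h1m h2p h2m h3p h3m h4p h4m
    simp only [curveCount, neg_neg, h1p, h1m, h2p, h2m, h3p, h3m, h4p, h4m]

/-- Let `d = u₀ ± t • cross n u₀ ± t ^ 2 • n`. Then `cross u₀ d` is `± t • n ± t ^ 2 • cross u₀ n`,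
which approaches the line of `n` from a side chosen by the signs. All four sign choices give `k`
vertices; the exchange identity removes the other directions and leaves twice the difference of the
two side counts. -/
theorem sideCount_eq_of_isEquiprojective {A : Set E3} (hfin : A.Finite)
    (hA : vectorSpan ℝ A = ⊤) (h : IsEquiprojective (convexHull ℝ A)) {u₀ n : E3}
    (hu₀ : IsNormalized u₀) (hn : n ≠ 0) (hnu : ⟪n, u₀⟫_ℝ = 0) :
    sideCount A u₀ n (cross u₀ n) = sideCount A u₀ n (-cross u₀ n) := by
  classical
  obtain ⟨k, -, -, hk⟩ := h
  have hne := nonempty_of_vectorSpan_eq_top hA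
  have hfinU := finite_setOf_edgeNormals_nonempty hfin
  -- Inserting `u₀` guarantees that its term can be split off even when it is not an edge direction.
  set U := insert u₀ hfinU.toFinset with hUdef
  have hU : ∀ u ∈ U, IsNormalized u := by
    intro u hu
    rcases Finset.mem_insert.1 hu with rfl | hu
    · exact hu₀
    · exact (hfinU.mem_toFinset.1 hu).1
  have hU' : ∀ u w, IsNormalized u → w ∈ edgeNormals A u → u ∈ U := fun u w hu hw =>
    Finset.mem_insert_of_mem (hfinU.mem_toFinset.2 ⟨hu, w, hw⟩)
  have hz0 : cross n u₀ ≠ 0 := cross_ne_zero_of_inner_eq_zero hn hu₀.ne_zero hnu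
  have hsum : ∀ z m : E3, (∀ q : E3, q ≠ 0 → ¬ (⟪q, u₀⟫_ℝ = 0 ∧ ⟪q, z⟫_ℝ = 0 ∧ ⟪q, m⟫_ℝ = 0)) →
      ∑ u ∈ U, curveCount A u (cross u u₀) (cross u z) (cross u m) = k := by
    intro z m hzm
    have hin : ∀ q : E3, ∀ᶠ t in 𝓝[>] (0 : ℝ), q ≠ 0 → ⟪q, u₀ + t • z + t ^ 2 • m⟫_ℝ ≠ 0 := by
      intro q
      by_cases hq : q = 0
      · exact Eventually.of_forall fun _ h => absurd hq h
      · filter_upwards [eventually_quadratic_ne_zero (hzm q hq)] with t ht _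
        simpa only [inner_add_right, inner_smul_right] using ht
    have hgen : ∀ᶠ t in 𝓝[>] (0 : ℝ), ∀ x ∈ A, ∀ y ∈ A, ∀ z' ∈ A, cross (y - x) (z' - x) ≠ 0 →
        ⟪cross (y - x) (z' - x), u₀ + t • z + t ^ 2 • m⟫_ℝ ≠ 0 :=
      (Set.Finite.eventually_all hfin).2 fun x _ => (Set.Finite.eventually_all hfin).2 fun y _ =>
        (Set.Finite.eventually_all hfin).2 fun z' _ => hin _
    have hcount : ∀ᶠ t in 𝓝[>] (0 : ℝ), ∀ u ∈ U,
        edgeCount A u (cross u u₀ + t • cross u z + t ^ 2 • cross u m) =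
          curveCount A u (cross u u₀) (cross u z) (cross u m) :=
      (Finset.eventually_all U).2 fun u _ => eventually_edgeCount_eq_curveCount hfin hne _ _ _ _
    obtain ⟨t, h1, h2, h3⟩ := ((hin u₀).and (hgen.and hcount)).exists
    have hd0 : u₀ + t • z + t ^ 2 • m ≠ 0 := by
      intro h0
      apply h1 hu₀.ne_zero
      rw [h0, inner_zero_right]
    have hg := isGenericDirection_of_forall_cross h2
    have h4 := hk _ hd0 ((forall_isFacet_iff_isGenericDirection hfin hA _).2 hg)
    rw [encard_extremePoints_projAlong hfin hA hd0 hg U hU hU'] at h4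
    rw [← Nat.cast_inj (R := ℕ∞), ← h4]
    congr 1
    refine Finset.sum_congr rfl fun u hu => ?_
    rw [← h3 u hu, cross_add_right, cross_add_right, cross_smul_right, cross_smul_right]
  -- The vectors `u₀`, `cross n u₀` and `n` form a basis, so no fixed nonzero `q` stays orthogonal
  -- to the curve for small `t > 0`.
  have hindep : ∀ q : E3, q ≠ 0 → ¬ (⟪q, u₀⟫_ℝ = 0 ∧ ⟪q, cross n u₀⟫_ℝ = 0 ∧ ⟪q, n⟫_ℝ = 0) := by
    rintro q hq ⟨h1, h2, h3⟩
    obtain ⟨c, rfl⟩ := exists_smul_cross hz0 h3 h1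
    rw [real_inner_smul_left] at h2
    rcases mul_eq_zero.1 h2 with h | h
    · exact hq (by rw [h, zero_smul])
    · exact hz0 (inner_self_eq_zero.1 h)
  have hneg : ∀ a b : E3, cross a (-b) = -cross a b := by
    intro a b
    rw [← neg_one_smul ℝ b, cross_smul_right, neg_one_smul]
  have s1 := hsum (cross n u₀) n hindep
  have s2 := hsum (-cross n u₀) (-n) (by simpa only [inner_neg_right, neg_eq_zero] using hindep)
  have s3 := hsum (cross n u₀) (-n) (by simpa only [inner_neg_right, neg_eq_zero] using hindep)
  have s4 := hsum (-cross n u₀) n (by simpa only [inner_neg_right, neg_eq_zero] using hindep)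
  simp only [hneg] at s2 s3 s4
  have hu₀U : u₀ ∈ U := Finset.mem_insert_self _ _
  have e1 : cross u₀ (cross n u₀) = n := by
    rw [cross_cross, real_inner_self_eq_norm_sq, hu₀.1, real_inner_comm, hnu]; simp
  rw [← Finset.add_sum_erase U _ hu₀U, e1] at s1 s2 s3 s4
  have hrest : ∑ u ∈ U.erase u₀,
        curveCount A u (cross u u₀) (cross u (cross n u₀)) (cross u n) +
      ∑ u ∈ U.erase u₀, curveCount A u (cross u u₀) (-cross u (cross n u₀)) (-cross u n) =
      ∑ u ∈ U.erase u₀, curveCount A u (cross u u₀) (cross u (cross n u₀)) (-cross u n) +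
      ∑ u ∈ U.erase u₀, curveCount A u (cross u u₀) (-cross u (cross n u₀)) (cross u n) := by
    rw [← Finset.sum_add_distrib, ← Finset.sum_add_distrib]
    refine Finset.sum_congr rfl fun u hu => ?_
    obtain ⟨hne', hu⟩ := Finset.mem_erase.1 hu
    exact curveCount_exchange A (hU u hu) hu₀ hne' hnu
  have t1 : ∀ m : E3, curveCount A u₀ (cross u₀ u₀) n m = sideCount A u₀ n m := by
    intro m
    rw [curveCount, sideCount, cross_self, neg_zero, face_zero]
  have t2 : ∀ m : E3, curveCount A u₀ (cross u₀ u₀) (-n) m = sideCount A u₀ n (-m) := by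
    intro m
    rw [curveCount, sideCount, cross_self, neg_zero, face_zero, neg_neg, neg_neg, add_comm]
  rw [t1] at s1 s3
  rw [t2] at s2 s4
  rw [neg_neg] at s2
  omega

theorem IsEquiprojective.isBalanced {A : Set E3} (hfin : A.Finite)
    (h : IsEquiprojective (convexHull ℝ A)) : IsBalanced A := by
  have hA : vectorSpan ℝ A = ⊤ := by
    obtain ⟨k, -, hd, -⟩ := h
    exact dim_convexHull_eq_three_iff.1 hd
  intro u hu
  obtain ⟨c, hc⟩ := exists_edgeCount_eq hfin (nonempty_of_vectorSpan_eq_top hA) hu.ne_zero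
    fun n hn hnu => sideCount_eq_of_isEquiprojective hfin hA h hu hn hnu
  refine ⟨c, fun w hw hreg => hc w ?_ hw hreg⟩
  rintro rfl
  exact not_isRegularNormal_zero hA hreg.1

/-! ### Polygons and line segments are balanced -/

/-- When `u` is parallel to the plane of `A`, with normal `n`, the face exposed by `w` depends only
on the sign of its component along `cross u n`. Changing this sign exchanges `w` and `-w` in the
count, and a zero component exposes all of `A`, which is not collinear. -/
theorem isBalanced_of_finrank_eq_two {A : Set E3}
    (hA : Module.finrank ℝ (vectorSpan ℝ A) = 2) : IsBalanced A := by
  have hperp : (vectorSpan ℝ A)ᗮ ≠ ⊥ := by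
    intro h
    have h1 := Submodule.finrank_add_finrank_orthogonal (vectorSpan ℝ A)
    rw [h, finrank_bot, hA, finrank_euclideanSpace_fin] at h1
    omega
  obtain ⟨n, hn, hn0⟩ := Submodule.exists_mem_ne_zero_of_ne_bot hperp
  have horth : ∀ z ∈ vectorSpan ℝ A, ⟪n, z⟫_ℝ = 0 := (Submodule.mem_orthogonal' _ _).1 hn
  have hconst : ∀ α : ℝ, ∀ x ∈ A, ∀ y ∈ A, ⟪α • n, x⟫_ℝ = ⟪α • n, y⟫_ℝ := by
    intro α x hx y hy
    have := horth _ (vsub_mem_vectorSpan ℝ hx hy)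
    rw [vsub_eq_sub, inner_sub_right] at this
    rw [real_inner_smul_left, real_inner_smul_left, sub_eq_zero.1 this]
  intro u hu
  by_cases hnu : ⟪n, u⟫_ℝ = 0
  · refine ⟨edgeCount A u (cross u n), fun w hw hreg => ?_⟩
    obtain ⟨α, β, rfl⟩ := exists_combination hu.ne_zero hn0 hnu hw
    have e : -(α • n + β • cross u n) = (-α) • n + β • -cross u n := by module
    have f1 := face_add_of_const (w := β • cross u n) (hconst α)
    have f2 := face_add_of_const (w := β • -cross u n) (hconst (-α))
    rcases lt_trichotomy β 0 with hβ | hβ | hβ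
    · have e1 : β • cross u n = (-β) • -cross u n := by module
      have e2 : β • -cross u n = (-β) • cross u n := by module
      rw [edgeCount_eq, edgeCount_eq, e, f1, f2, e1, e2, face_smul _ (neg_pos.2 hβ),
        face_smul _ (neg_pos.2 hβ), add_comm]
    · exfalso
      have := hreg.1
      rw [IsRegularNormal, f1, hβ, zero_smul, face_zero, hA] at this
      omega
    · rw [edgeCount_eq, edgeCount_eq, e, f1, f2, face_smul _ hβ, face_smul _ hβ]
  · have hno : ∀ w, w ∉ edgeNormals A u := by
      intro w hw
      apply hnu
      apply horth
      apply vectorSpan_mono ℝ (face_subset A w)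
      rw [show vectorSpan ℝ (face A w) = _ from hw]
      exact Submodule.mem_span_singleton_self u
    exact ⟨0, fun w _ _ => edgeCount_eq_zero (hno _) (hno _)⟩

theorem isBalanced_of_vectorSpan_eq_span {A : Set E3} {v : E3}
    (hA : vectorSpan ℝ A = Submodule.span ℝ {v}) : IsBalanced A := by
  intro u hu
  by_cases huv : vectorSpan ℝ A = Submodule.span ℝ {u}
  · have hall : ∀ w, ⟪w, u⟫_ℝ = 0 → w ∈ edgeNormals A u := by
      intro w hw
      rw [edgeNormals, Set.mem_ofPred_eq,
        face_eq_self_of_const (inner_eq_of_vectorSpan_le huv.le hw), huv]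
    refine ⟨2, fun w hw _ => ?_⟩
    have h1 := hall w hw
    have h2 := hall (-w) (by rw [inner_neg_left, hw, neg_zero])
    simp [edgeCount, h1, h2]
  · have hno : ∀ w, w ∉ edgeNormals A u := by
      intro w hw
      apply huv
      have hle := vectorSpan_mono ℝ (face_subset A w)
      rw [show vectorSpan ℝ (face A w) = _ from hw] at hle
      refine vectorSpan_eq_span_of_finrank_le_one ?_ hu.ne_zero
        (hle (Submodule.mem_span_singleton_self u))
      rw [hA]
      exact finrank_span_singleton_le_one v
    exact ⟨0, fun w _ _ => edgeCount_eq_zero (hno _) (hno _)⟩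

theorem exists_isBalanced {P : Set E3}
    (hP : IsEquiprojective P ∨ IsPolygon P ∨ IsLineSegment P) :
    ∃ S : Finset E3, S.Nonempty ∧ P = convexHull ℝ (S : Set E3) ∧ IsBalanced (S : Set E3) := by
  classical
  rcases hP with hP | ⟨⟨S, hS, rfl⟩, hdim⟩ | ⟨a, b, -, rfl⟩
  · obtain ⟨k, ⟨S, hS, rfl⟩, -⟩ := id hP
    exact ⟨S, hS, rfl, hP.isBalanced S.finite_toSet⟩
  · refine ⟨S, hS, rfl, isBalanced_of_finrank_eq_two ?_⟩
    rwa [dim, vectorSpan_convexHull] at hdim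
  · refine ⟨{a, b}, ⟨a, by simp⟩, by simp [convexHull_pair], ?_⟩
    apply isBalanced_of_vectorSpan_eq_span (v := a -ᵥ b)
    rw [Finset.coe_pair, vectorSpan_pair]

/-! ### Aggregated cones -/

theorem mem_perp {u w : E3} : w ∈ perp u ↔ ⟪w, u⟫_ℝ = 0 :=
  Submodule.mem_orthogonal_singleton_iff_inner_left

theorem mem_normalCone_face_iff {A : Set E3} (hfin : A.Finite) (hne : A.Nonempty) {v w : E3} :
    w ∈ normalCone (convexHull ℝ A) (face (convexHull ℝ A) v) ↔ face A v ⊆ face A w := by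
  constructor
  · intro h x hx
    refine ⟨hx.1, fun y hy => h y (subset_convexHull ℝ A hy) x ?_⟩
    rw [face_convexHull hfin hne]
    exact subset_convexHull ℝ _ hx
  · intro h x hx y hy
    rw [face_convexHull hfin hne] at hy
    have hy' := convexHull_mono h hy
    rw [← face_convexHull hfin hne] at hy'
    exact hy'.2 x hx

theorem isClosed_normalCone (P F : Set E3) : IsClosed (normalCone P F) := by
  have : normalCone P F = ⋂ x ∈ P, ⋂ y ∈ F, {v : E3 | ⟪v, x⟫_ℝ ≤ ⟪v, y⟫_ℝ} := by
    ext v; simp [normalCone]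
  rw [this]
  exact isClosed_biInter fun x _ => isClosed_biInter fun y _ =>
    isClosed_le (by fun_prop) (by fun_prop)

/-- Small displacements of `w` inside `u^⊥` keep the exposed face, so the normal cone at that face
spans the plane. -/
theorem edgeNormals_subset_aggregatedCone {A : Set E3} (hfin : A.Finite) (hne : A.Nonempty)
    {u : E3} (hu : u ≠ 0) : edgeNormals A u ⊆ aggregatedCone (convexHull ℝ A) u := by
  intro w hw
  have hw' : vectorSpan ℝ (face A w) = Submodule.span ℝ {u} := hw
  set N := normalCone (convexHull ℝ A) (face (convexHull ℝ A) w) with hN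
  have hNu : N ⊆ perp u := by
    intro v hv
    rw [hN, mem_normalCone_face_iff hfin hne] at hv
    refine mem_perp.2 (inner_eq_zero_of_mem_vectorSpan_face (A := A)
      (vectorSpan_mono ℝ hv ?_))
    rw [hw']
    exact Submodule.mem_span_singleton_self u
  have hwN : w ∈ N := (mem_normalCone_face_iff hfin hne).2 subset_rfl
  have hspan : Submodule.span ℝ N = (Submodule.span ℝ {u})ᗮ := by
    apply le_antisymm (Submodule.span_le.2 hNu)
    intro z hz
    have hzu := Submodule.mem_orthogonal_singleton_iff_inner_left.1 hz
    obtain ⟨t, h1, h0⟩ :=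
      ((eventually_face_add_smul hfin hne w z).and self_mem_nhdsWithin).exists
    rw [face_eq_self_of_const (inner_eq_of_vectorSpan_le hw'.le hzu)] at h1
    have h2 : w + t • z ∈ N := (mem_normalCone_face_iff hfin hne).2 h1.symm.subset
    have h3 : t • z ∈ Submodule.span ℝ N := by
      have := Submodule.sub_mem (Submodule.span ℝ N) (Submodule.subset_span h2)
        (Submodule.subset_span hwN)
      rwa [add_sub_cancel_left] at this
    exact (Submodule.smul_mem_iff _ (ne_of_gt h0)).1 h3
  refine ⟨N, ⟨_, (isFace_iff_exists_face hfin hne).2 ⟨w, rfl⟩, rfl, ?_, hNu⟩, hwN⟩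
  rw [coneDim, hspan, finrank_orthogonal_span_singleton_eq_two hu]

/-- A vector `v` exposing the face of a 2-dimensional cone `N` is an edge normal, and for `w` in `N`
the vectors `w + t • v` expose the same face for small `t > 0` and tend to `w`. -/
theorem aggregatedCone_subset_closure {A : Set E3} (hfin : A.Finite) (hne : A.Nonempty)
    {u : E3} (hu : u ≠ 0) : aggregatedCone (convexHull ℝ A) u ⊆ closure (edgeNormals A u) := by
  rintro w ⟨N, ⟨F, hF, hNF, hdim, hNu⟩, hwN⟩
  obtain ⟨v, rfl⟩ := (isFace_iff_exists_face hfin hne).1 hF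
  have hmem : ∀ x, x ∈ N ↔ face A v ⊆ face A x := fun x => by
    rw [hNF, mem_normalCone_face_iff hfin hne]
  have hspan : Submodule.span ℝ N = (Submodule.span ℝ {u})ᗮ := by
    apply Submodule.eq_of_le_of_finrank_eq (Submodule.span_le.2 hNu)
    rw [finrank_orthogonal_span_singleton_eq_two hu]
    exact hdim
  have hle : vectorSpan ℝ (face A v) ≤ Submodule.span ℝ {u} := by
    intro z hz
    have h1 : N ⊆ ((Submodule.span ℝ {z})ᗮ : Submodule ℝ E3) := fun x hx =>
      Submodule.mem_orthogonal_singleton_iff_inner_left.2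
        (inner_eq_zero_of_mem_vectorSpan_face (vectorSpan_mono ℝ ((hmem x).1 hx) hz))
    have h2 : (Submodule.span ℝ {u})ᗮ ≤ (Submodule.span ℝ {z})ᗮ :=
      hspan ▸ Submodule.span_le.2 h1
    have h3 := Submodule.orthogonal_le h2
    rw [Submodule.orthogonal_orthogonal, Submodule.orthogonal_orthogonal] at h3
    exact h3 (Submodule.mem_span_singleton_self z)
  have hvG : v ∈ edgeNormals A u := by
    refine (eq_bot_or_eq_span_of_le_span hle).resolve_left fun hbot => ?_
    have hsub : (face A v).Subsingleton := by
      intro x hx y hy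
      have := vsub_mem_vectorSpan ℝ hx hy
      rw [hbot, Submodule.mem_bot, vsub_eq_sub, sub_eq_zero] at this
      exact this
    -- At a vertex the normal cone contains a neighbourhood of `v`, so it would have dimension 3.
    have hnhds : ∀ᶠ x in 𝓝 v, x ∈ Submodule.span ℝ N := by
      filter_upwards [eventually_face_subset hfin v] with x hx
      apply Submodule.subset_span
      obtain ⟨y, hy⟩ := face_nonempty hfin hne x
      exact (hmem x).2 fun z hz => hsub (hx hy) hz ▸ hy
    have htop := Submodule.eq_top_of_nonempty_interior' (Submodule.span ℝ N)
      ⟨v, mem_interior_iff_mem_nhds.2 hnhds⟩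
    rw [coneDim, htop, finrank_top, finrank_euclideanSpace_fin] at hdim
    omega
  refine mem_closure_of_tendsto (tendsto_add_smul w v) ?_
  filter_upwards [eventually_face_add_smul hfin hne w v] with t ht
  have hsub := (hmem w).1 hwN
  obtain ⟨y, hy⟩ := face_nonempty hfin hne v
  have : face (face A w) v = face A v := by
    apply subset_antisymm
    · exact fun x hx => ⟨hx.1.1, fun z hz => (hy.2 z hz).trans (hx.2 y (hsub hy))⟩
    · exact fun x hx => ⟨hsub hx, fun z hz => hx.2 z hz.1⟩
  rw [edgeNormals, Set.mem_ofPred_eq, ht, this]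
  exact hvG

theorem isClosed_aggregatedCone {A : Set E3} (hfin : A.Finite) (hne : A.Nonempty) (u : E3) :
    IsClosed (aggregatedCone (convexHull ℝ A) u) := by
  rw [aggregatedCone, Set.sUnion_eq_biUnion]
  apply Set.Finite.isClosed_biUnion
  · apply (hfin.powerset.image
      fun X => normalCone (convexHull ℝ A) (convexHull ℝ X)).subset
    rintro N ⟨F, hF, rfl, -, -⟩
    obtain ⟨v, rfl⟩ := (isFace_iff_exists_face hfin hne).1 hF
    exact ⟨face A v, face_subset A v, by rw [face_convexHull hfin hne]⟩
  · rintro N ⟨F, -, rfl, -, -⟩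
    exact isClosed_normalCone _ _

theorem aggregatedCone_eq_closure {A : Set E3} (hfin : A.Finite) (hne : A.Nonempty)
    {u : E3} (hu : u ≠ 0) : aggregatedCone (convexHull ℝ A) u = closure (edgeNormals A u) :=
  subset_antisymm (aggregatedCone_subset_closure hfin hne hu)
    (closure_minimal (edgeNormals_subset_aggregatedCone hfin hne hu)
      (isClosed_aggregatedCone hfin hne u))

theorem isEdgeDirection_iff {A : Set E3} (hfin : A.Finite) (hne : A.Nonempty) {u : E3} :
    IsEdgeDirection (convexHull ℝ A) u ↔ IsNormalized u ∧ (edgeNormals A u).Nonempty := by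
  constructor
  · rintro ⟨h1, h2, e, ⟨he, hdim⟩, x, hx, y, hy, hxy, c, hc⟩
    have hu : IsNormalized u := ⟨h1, h2⟩
    refine ⟨hu, ?_⟩
    obtain ⟨w, rfl⟩ := (isFace_iff_exists_face hfin hne).1 he
    refine ⟨w, ?_⟩
    rw [dim] at hdim
    have hc0 : c ≠ 0 := by
      rintro rfl
      rw [zero_smul, sub_eq_zero] at hc
      exact hxy hc.symm
    have hmem : u ∈ vectorSpan ℝ (face (convexHull ℝ A) w) := by
      have := vsub_mem_vectorSpan ℝ hy.1 hx.1
      rw [vsub_eq_sub, hc] at this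
      exact (Submodule.smul_mem_iff _ hc0).1 this
    have := vectorSpan_eq_span_of_finrank_le_one hdim.le hu.ne_zero hmem
    rwa [vectorSpan_face_convexHull hfin hne] at this
  · rintro ⟨hu, w, hw⟩
    have hspan : vectorSpan ℝ (face (convexHull ℝ A) w) = Submodule.span ℝ {u} := by
      rw [vectorSpan_face_convexHull hfin hne]; exact hw
    refine ⟨hu.1, hu.2, face (convexHull ℝ A) w,
      ⟨(isFace_iff_exists_face hfin hne).2 ⟨w, rfl⟩, ?_⟩, ?_⟩
    · rw [dim, hspan, finrank_span_singleton hu.ne_zero]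
    · set e := face (convexHull ℝ A) w with he
      have hek : e = convexHull ℝ (face A w) := face_convexHull hfin hne w
      have hcomp : IsCompact e := by
        rw [hek]; exact (face_finite hfin w).isCompact_convexHull ℝ
      have hconv : Convex ℝ e := by rw [hek]; exact convex_convexHull ℝ _
      have hnt : (e.extremePoints ℝ).Nontrivial := by
        by_contra hsub
        rw [Set.not_nontrivial_iff] at hsub
        have h1 := closure_convexHull_extremePoints hcomp hconv
        have h2 := (exists_ne_of_vectorSpan_eq hu.ne_zero hspan)
        rw [← h1] at h2
        rcases hsub.eq_empty_or_singleton with h0 | ⟨x, h0⟩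
        · rw [h0, convexHull_empty, closure_empty] at h2
          exact Set.not_nontrivial_empty h2
        · rw [h0, convexHull_singleton, closure_singleton] at h2
          exact Set.not_nontrivial_singleton h2
      obtain ⟨x, hx, y, hy, hxy⟩ := hnt
      refine ⟨x, hx, y, hy, hxy, ?_⟩
      have := vsub_mem_vectorSpan ℝ hy.1 hx.1
      rw [hspan] at this
      obtain ⟨c, hc⟩ := Submodule.mem_span_singleton.1 this
      exact ⟨c, hc.symm⟩

/-! ### Minkowski sums -/

theorem face_add (A B : Set E3) (w : E3) : face (A + B) w = face A w + face B w := by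
  ext x
  constructor
  · rintro ⟨⟨a, ha, b, hb, rfl⟩, h⟩
    refine ⟨a, ⟨ha, fun y hy => ?_⟩, b, ⟨hb, fun y hy => ?_⟩, rfl⟩
    · have := h _ (Set.add_mem_add hy hb)
      dsimp only at this
      rw [inner_add_right, inner_add_right] at this
      linarith
    · have := h _ (Set.add_mem_add ha hy)
      dsimp only at this
      rw [inner_add_right, inner_add_right] at this
      linarith
  · rintro ⟨a, ha, b, hb, rfl⟩
    refine ⟨Set.add_mem_add ha.1 hb.1, ?_⟩
    rintro _ ⟨a', ha', b', hb', rfl⟩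
    dsimp only
    rw [inner_add_right, inner_add_right]
    linarith [ha.2 a' ha', hb.2 b' hb']

theorem vectorSpan_add {X Y : Set E3} (hX : X.Nonempty) (hY : Y.Nonempty) :
    vectorSpan ℝ (X + Y) = vectorSpan ℝ X ⊔ vectorSpan ℝ Y := by
  obtain ⟨x₀, hx₀⟩ := hX
  obtain ⟨y₀, hy₀⟩ := hY
  apply le_antisymm
  · rw [vectorSpan_def, Submodule.span_le]
    rintro _ ⟨_, ⟨x, hx, y, hy, rfl⟩, _, ⟨x', hx', y', hy', rfl⟩, rfl⟩
    have : (x + y) -ᵥ (x' + y') = (x -ᵥ x') + (y -ᵥ y') := by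
      simp only [vsub_eq_sub]; abel
    dsimp only
    rw [this]
    exact Submodule.add_mem_sup (vsub_mem_vectorSpan ℝ hx hx') (vsub_mem_vectorSpan ℝ hy hy')
  · apply sup_le
    · rw [vectorSpan_def, Submodule.span_le]
      rintro _ ⟨x, hx, x', hx', rfl⟩
      have := vsub_mem_vectorSpan ℝ (Set.add_mem_add hx hy₀) (Set.add_mem_add hx' hy₀)
      simpa using this
    · rw [vectorSpan_def, Submodule.span_le]
      rintro _ ⟨y, hy, y', hy', rfl⟩
      have := vsub_mem_vectorSpan ℝ (Set.add_mem_add hx₀ hy) (Set.add_mem_add hx₀ hy')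
      simpa using this

section Sum

variable {A B : Set E3}

theorem vectorSpan_face_add (hA : A.Finite) (hA' : A.Nonempty) (hB : B.Finite)
    (hB' : B.Nonempty) (w : E3) :
    vectorSpan ℝ (face (A + B) w) = vectorSpan ℝ (face A w) ⊔ vectorSpan ℝ (face B w) := by
  rw [face_add, vectorSpan_add (face_nonempty hA hA' w) (face_nonempty hB hB' w)]

theorem IsBiregular.of_add (hA : A.Finite) (hA' : A.Nonempty) (hB : B.Finite)
    (hB' : B.Nonempty) {w : E3} (h : IsBiregular (A + B) w) :
    IsBiregular A w ∧ IsBiregular B w := by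
  have h1 := h.1
  have h2 := h.2
  rw [IsRegularNormal, vectorSpan_face_add hA hA' hB hB'] at h1 h2
  exact ⟨⟨(Submodule.finrank_mono le_sup_left).trans h1,
    (Submodule.finrank_mono le_sup_left).trans h2⟩,
    ⟨(Submodule.finrank_mono le_sup_right).trans h1,
    (Submodule.finrank_mono le_sup_right).trans h2⟩⟩

/-- The directions of the two faces add up, and two subspaces of a line span that line exactly when
one of them is the line. -/
theorem mem_edgeNormals_add_iff (hA : A.Finite) (hA' : A.Nonempty) (hB : B.Finite)
    (hB' : B.Nonempty) {u w : E3} (hu : u ≠ 0) (h : IsRegularNormal (A + B) w) :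
    w ∈ edgeNormals (A + B) u ↔ w ∈ edgeNormals A u ∨ w ∈ edgeNormals B u := by
  have hs := vectorSpan_face_add hA hA' hB hB' w
  constructor
  · intro hw
    have hw' : vectorSpan ℝ (face (A + B) w) = Submodule.span ℝ {u} := hw
    rw [hs] at hw'
    rcases eq_bot_or_eq_span_of_le_span (le_sup_left.trans hw'.le) with h1 | h1
    · rcases eq_bot_or_eq_span_of_le_span (le_sup_right.trans hw'.le) with h2 | h2
      · rw [h1, h2, bot_sup_eq] at hw'
        exact absurd (Submodule.span_singleton_eq_bot.1 hw'.symm) hu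
      · exact Or.inr h2
    · exact Or.inl h1
  · intro hw
    apply vectorSpan_eq_span_of_finrank_le_one h hu
    rw [hs]
    rcases hw with hw | hw
    · apply Submodule.mem_sup_left
      rw [show vectorSpan ℝ (face A w) = _ from hw]
      exact Submodule.mem_span_singleton_self u
    · apply Submodule.mem_sup_right
      rw [show vectorSpan ℝ (face B w) = _ from hw]
      exact Submodule.mem_span_singleton_self u

end Sum

/-! ### Density of generic vectors and closures of edge normals -/

theorem IsBiregular.smul {A : Set E3} {w : E3} (h : IsBiregular A w) {t : ℝ} (ht : 0 < t) :
    IsBiregular A (t • w) := by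
  rw [IsBiregular, IsRegularNormal, IsRegularNormal, face_smul _ ht, ← smul_neg, face_smul _ ht]
  exact h

theorem IsBiregular.neg {A : Set E3} {w : E3} (h : IsBiregular A w) : IsBiregular A (-w) :=
  ⟨h.2, by rw [neg_neg]; exact h.1⟩

theorem mem_closure_isBiregular {A : Set E3} (hfin : A.Finite) (hne : A.Nonempty) {u w : E3}
    (hu : u ≠ 0) (hw : ⟪w, u⟫_ℝ = 0) : w ∈ closure {v | ⟪v, u⟫_ℝ = 0 ∧ IsBiregular A v} := by
  by_cases hw0 : w = 0
  · obtain ⟨n, hn, hnu⟩ := exists_ne_zero_inner_eq_zero u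
    obtain ⟨t, ht⟩ := (eventually_isBiregular hfin hne hu hn hnu).exists
    have h := tendsto_add_smul w (n + t • cross u n)
    refine mem_closure_of_tendsto h ?_
    filter_upwards [self_mem_nhdsWithin] with s hs
    rw [hw0, zero_add]
    refine ⟨?_, ht.smul hs⟩
    rw [real_inner_smul_left, inner_add_smul_cross hnu, mul_zero]
  · refine mem_closure_of_tendsto (tendsto_add_smul w (cross u w)) ?_
    filter_upwards [eventually_isBiregular hfin hne hu hw0 hw] with t ht
    exact ⟨inner_add_smul_cross hw t, ht⟩

/-- Edge normals are relatively open in `u^⊥` and biregular vectors of `M` are dense there, so a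
closed condition need only be tested at generic edge normals. -/
theorem closure_edgeNormals_subset {A M : Set E3} (hfin : A.Finite) (hne : A.Nonempty)
    (hM : M.Finite) (hM' : M.Nonempty) {u : E3} (hu : u ≠ 0) {C : Set E3} (hC : IsClosed C)
    (h : ∀ w ∈ edgeNormals A u, IsBiregular M w → w ∈ C) : closure (edgeNormals A u) ⊆ C := by
  apply closure_minimal _ hC
  intro w hw
  rw [← hC.closure_eq]
  have h1 := mem_closure_iff_frequently.1
    (mem_closure_isBiregular hM hM' hu (inner_eq_zero_of_mem_edgeNormals hw))
  apply mem_closure_iff_frequently.2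
  refine (h1.and_eventually (eventually_mem_edgeNormals_iff hfin hne hu
    (isRegularNormal_of_mem_edgeNormals hw))).mono ?_
  rintro v ⟨⟨hv, hreg⟩, hiff⟩
  exact h v ((hiff hv).2 hw) hreg

theorem mem_edgeNormals_of_mem_closure {A : Set E3} (hfin : A.Finite) (hne : A.Nonempty)
    {u w : E3} (hu : u ≠ 0) (hreg : IsRegularNormal A w) (hw : w ∈ closure (edgeNormals A u)) :
    w ∈ edgeNormals A u := by
  obtain ⟨v, hv, hiff⟩ := ((mem_closure_iff_frequently.1 hw).and_eventually
    (eventually_mem_edgeNormals_iff hfin hne hu hreg)).exists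
  exact (hiff (inner_eq_zero_of_mem_edgeNormals hv)).1 hv

theorem closure_edgeNormals_subset_perp (A : Set E3) (u : E3) :
    closure (edgeNormals A u) ⊆ perp u :=
  closure_minimal (fun _ hw => mem_perp.2 (inner_eq_zero_of_mem_edgeNormals hw))
    (Submodule.isClosed_orthogonal _)

/-! ### The criterion for a Minkowski sum to be balanced -/

section Main

variable {A B : Set E3}

theorem edgeCount_add_eq (hA : A.Finite) (hA' : A.Nonempty) (hB : B.Finite)
    (hB' : B.Nonempty) {u w : E3} (hu : u ≠ 0) (h : IsBiregular (A + B) w) [Decidable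
      (w ∈ edgeNormals A u ∨ w ∈ edgeNormals B u)] [Decidable
      (-w ∈ edgeNormals A u ∨ -w ∈ edgeNormals B u)] :
    edgeCount (A + B) u w =
      (if w ∈ edgeNormals A u ∨ w ∈ edgeNormals B u then 1 else 0) +
        (if -w ∈ edgeNormals A u ∨ -w ∈ edgeNormals B u then 1 else 0) := by
  simp only [edgeCount, mem_edgeNormals_add_iff hA hA' hB hB' hu h.1,
    mem_edgeNormals_add_iff hA hA' hB hB' hu h.2]

theorem isBalanced_add (hA : A.Finite) (hA' : A.Nonempty) (hB : B.Finite)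
    (hB' : B.Nonempty) (hbA : IsBalanced A) (hbB : IsBalanced B)
    (h : ∀ u, IsNormalized u → (edgeNormals A u).Nonempty → (edgeNormals B u).Nonempty →
      (closure (edgeNormals A u) = perp u ∨ closure (edgeNormals B u) = perp u) ∨
      (closure (edgeNormals A u) = closure (edgeNormals B u) ∨
        closure (edgeNormals A u) = -closure (edgeNormals B u))) :
    IsBalanced (A + B) := by
  classical
  intro u hu
  have hu0 := hu.ne_zero
  obtain ⟨cA, hcA⟩ := hbA u hu
  obtain ⟨cB, hcB⟩ := hbB u hu
  have hcount : ∀ w, IsBiregular (A + B) w → edgeCount (A + B) u w =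
      (if w ∈ edgeNormals A u ∨ w ∈ edgeNormals B u then 1 else 0) +
        (if -w ∈ edgeNormals A u ∨ -w ∈ edgeNormals B u then 1 else 0) :=
    fun w hw => edgeCount_add_eq hA hA' hB hB' hu0 hw
  have hmA : ∀ w, IsRegularNormal A w →
      (w ∈ edgeNormals A u ↔ w ∈ closure (edgeNormals A u)) := fun w hw =>
    ⟨fun h => subset_closure h, mem_edgeNormals_of_mem_closure hA hA' hu0 hw⟩
  have hmB : ∀ w, IsRegularNormal B w →
      (w ∈ edgeNormals B u ↔ w ∈ closure (edgeNormals B u)) := fun w hw =>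
    ⟨fun h => subset_closure h, mem_edgeNormals_of_mem_closure hB hB' hu0 hw⟩
  rcases (edgeNormals A u).eq_empty_or_nonempty with hGA | hGA
  · refine ⟨cB, fun w hw hreg => ?_⟩
    rw [hcount w hreg, ← hcB w hw (hreg.of_add hA hA' hB hB').2, hGA]
    simp [edgeCount]
  rcases (edgeNormals B u).eq_empty_or_nonempty with hGB | hGB
  · refine ⟨cA, fun w hw hreg => ?_⟩
    rw [hcount w hreg, ← hcA w hw (hreg.of_add hA hA' hB hB').1, hGB]
    simp [edgeCount]
  have hneg : ∀ w : E3, ⟪w, u⟫_ℝ = 0 → ⟪-w, u⟫_ℝ = 0 := fun w hw => by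
    rw [inner_neg_left, hw, neg_zero]
  rcases h u hu hGA hGB with (hc | hc) | (hc | hc)
  · refine ⟨2, fun w hw hreg => ?_⟩
    have hr := (hreg.of_add hA hA' hB hB').1
    have h1 : w ∈ edgeNormals A u := (hmA w hr.1).2 (hc ▸ mem_perp.2 hw)
    have h2 : -w ∈ edgeNormals A u := (hmA _ hr.2).2 (hc ▸ mem_perp.2 (hneg w hw))
    simp [hcount w hreg, h1, h2]
  · refine ⟨2, fun w hw hreg => ?_⟩
    have hr := (hreg.of_add hA hA' hB hB').2
    have h1 : w ∈ edgeNormals B u := (hmB w hr.1).2 (hc ▸ mem_perp.2 hw)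
    have h2 : -w ∈ edgeNormals B u := (hmB _ hr.2).2 (hc ▸ mem_perp.2 (hneg w hw))
    simp [hcount w hreg, h1, h2]
  · refine ⟨cA, fun w hw hreg => ?_⟩
    obtain ⟨hrA, hrB⟩ := hreg.of_add hA hA' hB hB'
    have h1 : w ∈ edgeNormals B u ↔ w ∈ edgeNormals A u := by
      rw [hmA w hrA.1, hmB w hrB.1, hc]
    have h2 : -w ∈ edgeNormals B u ↔ -w ∈ edgeNormals A u := by
      rw [hmA _ hrA.2, hmB _ hrB.2, hc]
    rw [hcount w hreg, ← hcA w hw hrA]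
    simp only [h1, h2, or_self, edgeCount]
  -- For opposite cones, `w` is an edge normal of the sum as soon as `w` or `-w` is one of `A`, and
  -- then so is `-w`. The count is therefore 2 unless `A` contributes nothing.
  · refine ⟨if cA = 0 then 0 else 2, fun w hw hreg => ?_⟩
    obtain ⟨hrA, hrB⟩ := hreg.of_add hA hA' hB hB'
    have h1 : w ∈ edgeNormals B u ↔ -w ∈ edgeNormals A u := by
      rw [hmA _ hrA.2, hmB w hrB.1, hc, Set.neg_mem_neg]
    have h2 : -w ∈ edgeNormals B u ↔ w ∈ edgeNormals A u := by
      rw [hmA _ hrA.1, hmB _ hrB.2, hc, Set.mem_neg]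
    rw [hcount w hreg, ← hcA w hw hrA]
    simp only [h1, h2, edgeCount]
    by_cases p : w ∈ edgeNormals A u <;> by_cases q : -w ∈ edgeNormals A u <;> simp [p, q]

theorem closure_edgeNormals_of_isBalanced_add (hA : A.Finite) (hA' : A.Nonempty)
    (hB : B.Finite) (hB' : B.Nonempty) (hbA : IsBalanced A) (hbB : IsBalanced B)
    (hbAB : IsBalanced (A + B)) {u : E3} (hu : IsNormalized u)
    (hGA : (edgeNormals A u).Nonempty) (hGB : (edgeNormals B u).Nonempty) :
    (closure (edgeNormals A u) = perp u ∨ closure (edgeNormals B u) = perp u) ∨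
      (closure (edgeNormals A u) = closure (edgeNormals B u) ∨
        closure (edgeNormals A u) = -closure (edgeNormals B u)) := by
  classical
  have hu0 := hu.ne_zero
  have hM : (A + B).Finite := hA.add hB
  have hM' : (A + B).Nonempty := hA'.add hB'
  obtain ⟨cA, hcA⟩ := hbA u hu
  obtain ⟨cB, hcB⟩ := hbB u hu
  obtain ⟨c, hc⟩ := hbAB u hu
  have hA1 : ∀ w, ⟪w, u⟫_ℝ = 0 → IsBiregular (A + B) w →
      (if w ∈ edgeNormals A u then 1 else 0) + (if -w ∈ edgeNormals A u then 1 else 0) = cA :=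
    fun w hw hreg => by
      rw [← hcA w hw (hreg.of_add hA hA' hB hB').1, edgeCount]
  have hB1 : ∀ w, ⟪w, u⟫_ℝ = 0 → IsBiregular (A + B) w →
      (if w ∈ edgeNormals B u then 1 else 0) + (if -w ∈ edgeNormals B u then 1 else 0) = cB :=
    fun w hw hreg => by
      rw [← hcB w hw (hreg.of_add hA hA' hB hB').2, edgeCount]
  have hAB1 : ∀ w, ⟪w, u⟫_ℝ = 0 → IsBiregular (A + B) w →
      (if w ∈ edgeNormals A u ∨ w ∈ edgeNormals B u then 1 else 0) +
        (if -w ∈ edgeNormals A u ∨ -w ∈ edgeNormals B u then 1 else 0) = c :=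
    fun w hw hreg => by rw [← hc w hw hreg, edgeCount_add_eq hA hA' hB hB' hu0 hreg]
  have hexists : ∀ {X : Set E3}, X.Finite → X.Nonempty → (edgeNormals X u).Nonempty →
      ∃ w ∈ edgeNormals X u, IsBiregular (A + B) w := by
    intro X hX hX' hG
    by_contra! hno
    have := closure_edgeNormals_subset hX hX' hM hM' hu0 isClosed_empty
      fun w hw hreg => hno w hw hreg
    obtain ⟨w, hw⟩ := hG
    exact this (subset_closure hw)
  have hfull : ∀ {X : Set E3}, (∀ w, ⟪w, u⟫_ℝ = 0 → IsBiregular (A + B) w →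
      w ∈ edgeNormals X u) → closure (edgeNormals X u) = perp u := by
    intro X hX
    apply subset_antisymm (closure_edgeNormals_subset_perp X u)
    intro w hw
    exact closure_mono (fun v hv => hX v hv.1 hv.2)
      (mem_closure_isBiregular hM hM' hu0 (mem_perp.1 hw))
  obtain ⟨a, ha, hareg⟩ := hexists hA hA' hGA
  obtain ⟨b, hb, hbreg⟩ := hexists hB hB' hGB
  have hau := inner_eq_zero_of_mem_edgeNormals ha
  have hbu := inner_eq_zero_of_mem_edgeNormals hb
  have a1 := hA1 a hau hareg
  have b1 := hB1 b hbu hbreg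
  have ab1 := hAB1 a hau hareg
  simp only [ha, hb, true_or, if_true] at a1 b1 ab1
  by_cases hA2 : cA = 2
  · refine Or.inl (Or.inl (hfull fun w hw hreg => ?_))
    have := hA1 w hw hreg
    by_contra hn
    rw [if_neg hn] at this
    split_ifs at this <;> omega
  by_cases hB2 : cB = 2
  · refine Or.inl (Or.inr (hfull fun w hw hreg => ?_))
    have := hB1 w hw hreg
    by_contra hn
    rw [if_neg hn] at this
    split_ifs at this <;> omega
  have hA3 : cA = 1 := by split_ifs at a1 <;> omega
  have hB3 : cB = 1 := by split_ifs at b1 <;> omega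
  right
  -- Each summand now selects exactly one of `w`, `-w`. Total count 2 means that the selections are
  -- always opposite, count 1 that they always agree.
  by_cases hc2 : c = 2
  · right
    have key : ∀ w, ⟪w, u⟫_ℝ = 0 → IsBiregular (A + B) w →
        (w ∈ edgeNormals A u ↔ -w ∈ edgeNormals B u) := by
      intro w hw hreg
      have e1 := hA1 w hw hreg
      have e2 := hB1 w hw hreg
      have e3 := hAB1 w hw hreg
      by_cases p : w ∈ edgeNormals A u <;> by_cases p' : -w ∈ edgeNormals A u <;>
        by_cases q : w ∈ edgeNormals B u <;> by_cases q' : -w ∈ edgeNormals B u <;>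
        simp [p, p', q, q'] at e1 e2 e3 ⊢ <;> omega
    apply subset_antisymm
    · refine closure_edgeNormals_subset hA hA' hM hM' hu0 isClosed_closure.neg ?_
      intro w hw hreg
      exact subset_closure ((key w (inner_eq_zero_of_mem_edgeNormals hw) hreg).1 hw)
    · rw [Set.neg_subset]
      refine closure_edgeNormals_subset hB hB' hM hM' hu0 isClosed_closure.neg ?_
      intro w hw hreg
      have hwu := inner_eq_zero_of_mem_edgeNormals hw
      exact subset_closure ((key (-w) (by rw [inner_neg_left, hwu, neg_zero]) hreg.neg).2
        (by rwa [neg_neg]))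
  · left
    have hc1 : c = 1 := by split_ifs at ab1 <;> omega
    have key : ∀ w, ⟪w, u⟫_ℝ = 0 → IsBiregular (A + B) w →
        (w ∈ edgeNormals A u ↔ w ∈ edgeNormals B u) := by
      intro w hw hreg
      have e1 := hA1 w hw hreg
      have e2 := hB1 w hw hreg
      have e3 := hAB1 w hw hreg
      by_cases p : w ∈ edgeNormals A u <;> by_cases p' : -w ∈ edgeNormals A u <;>
        by_cases q : w ∈ edgeNormals B u <;> by_cases q' : -w ∈ edgeNormals B u <;>
        simp [p, p', q, q'] at e1 e2 e3 ⊢ <;> omega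
    apply subset_antisymm
    · refine closure_edgeNormals_subset hA hA' hM hM' hu0 isClosed_closure ?_
      intro w hw hreg
      exact subset_closure ((key w (inner_eq_zero_of_mem_edgeNormals hw) hreg).1 hw)
    · refine closure_edgeNormals_subset hB hB' hM hM' hu0 isClosed_closure ?_
      intro w hw hreg
      exact subset_closure ((key w (inner_eq_zero_of_mem_edgeNormals hw) hreg).2 hw)

end Main

end EquiprojectivePolytopes

/-! ### Translation to polytopes and aggregated cones -/

theorem mainTheorem4
    (P Q : Set EquiprojectivePolytopes.E3)
    (hP : EquiprojectivePolytopes.IsEquiprojective P ∨ EquiprojectivePolytopes.IsPolygon P ∨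
      EquiprojectivePolytopes.IsLineSegment P)
    (hQ : EquiprojectivePolytopes.IsEquiprojective Q ∨ EquiprojectivePolytopes.IsPolygon Q ∨
      EquiprojectivePolytopes.IsLineSegment Q)
    (hPQ : EquiprojectivePolytopes.dim (P + Q) = 3) :
    EquiprojectivePolytopes.IsEquiprojective (P + Q) ↔
      ∀ u : EquiprojectivePolytopes.E3,
        EquiprojectivePolytopes.IsEdgeDirection P u →
        EquiprojectivePolytopes.IsEdgeDirection Q u →
          ((EquiprojectivePolytopes.aggregatedCone P u = EquiprojectivePolytopes.perp u ∨
            EquiprojectivePolytopes.aggregatedCone Q u = EquiprojectivePolytopes.perp u) ∨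
          (EquiprojectivePolytopes.aggregatedCone P u =
              EquiprojectivePolytopes.aggregatedCone Q u ∨
            EquiprojectivePolytopes.aggregatedCone P u =
              -EquiprojectivePolytopes.aggregatedCone Q u)) := by
  classical
  obtain ⟨S, hS, rfl, hbS⟩ := EquiprojectivePolytopes.exists_isBalanced hP
  obtain ⟨T, hT, rfl, hbT⟩ := EquiprojectivePolytopes.exists_isBalanced hQ
  have hSf := S.finite_toSet
  have hTf := T.finite_toSet
  have hsum : convexHull ℝ (S : Set EquiprojectivePolytopes.E3) + convexHull ℝ (T : Set _) =
      convexHull ℝ ((S + T : Finset EquiprojectivePolytopes.E3) : Set _) := by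
    rw [Finset.coe_add, convexHull_add]
  rw [hsum] at hPQ ⊢
  rw [EquiprojectivePolytopes.dim_convexHull_eq_three_iff] at hPQ
  constructor
  · intro h u hPu hQu
    have hbal := h.isBalanced (S + T).finite_toSet
    rw [Finset.coe_add] at hbal
    rw [EquiprojectivePolytopes.isEdgeDirection_iff hSf hS] at hPu
    rw [EquiprojectivePolytopes.isEdgeDirection_iff hTf hT] at hQu
    rw [EquiprojectivePolytopes.aggregatedCone_eq_closure hSf hS hPu.1.ne_zero,
      EquiprojectivePolytopes.aggregatedCone_eq_closure hTf hT hPu.1.ne_zero]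
    exact EquiprojectivePolytopes.closure_edgeNormals_of_isBalanced_add hSf hS hTf hT hbS hbT
      hbal hPu.1 hPu.2 hQu.2
  · intro h
    apply EquiprojectivePolytopes.IsBalanced.isEquiprojective hPQ
    rw [Finset.coe_add]
    refine EquiprojectivePolytopes.isBalanced_add hSf hS hTf hT hbS hbT fun u hu hSu hTu => ?_
    rw [← EquiprojectivePolytopes.aggregatedCone_eq_closure hSf hS hu.ne_zero,
      ← EquiprojectivePolytopes.aggregatedCone_eq_closure hTf hT hu.ne_zero]
    exact h u ((EquiprojectivePolytopes.isEdgeDirection_iff hSf hS).2 ⟨hu, hSu⟩)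
      ((EquiprojectivePolytopes.isEdgeDirection_iff hTf hT).2 ⟨hu, hTu⟩)
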